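/- Let $\widetilde{\mathcal M}=\mathbb C[[\varphi_{-i-1},\varphi^*_{-i}\mid i\ge 0]]\,|0\rangle$ be the completed Fock space of the charged free bosons $\varphi(z)=\sum_{i\in\mathbb Z}\varphi_i z^{-i-1}$, $\varphi^*(z)=\sum_{i\in\mathbb Z}\varphi^*_i z^{-i}$, where $[\varphi_i,\varphi^*_j]=\delta_{i,-j}$, $[\varphi_i,\varphi_j]=[\varphi^*_i,\varphi^*_j]=0$ and $\varphi_i|0\rangle=\varphi^*_{i+1}|0\rangle=0$ for $i\ge 0$. Let $\mathcal B=\mathbb C[[x,y;p,p^{-1}]]$ with $x=(x_1,x_2,\dots)$, $y=(y_1,y_2,\dots)$, that is, the space of all formal sums $\sum_{l\in\mathbb Z}f_l\,p^l$ with $f_l\in\mathbb C[[x,y]]$. The coefficients of powers of $z$ in $$\varphi^*(z)=p\,\exp\Big(\sum_{n>0}(x_n+y_n)z^n\Big)\Big(\sum_{k>0}kx_kz^{k-1}+\sum_{k>0}\frac{\partial}{\partial x_k}z^{-k-1}+p\frac{\partial}{\partial p}z^{-1}\Big)\exp\Big(-\sum_{n>0}\Big(\frac{\partial}{\partial x_n}-\frac{\partial}{\partial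 y_n}\Big)\frac{z^{-n}}{n}\Big),$$ $$\varphi(z)=p^{-1}\exp\Big(-\sum_{n>0}(x_n+y_n)z^n\Big)\exp\Big(\sum_{n>0}\Big(\frac{\partial}{\partial x_n}-\frac{\partial}{\partial y_n}\Big)\frac{z^{-n}}{n}\Big)$$ act on $\mathcal B$, and the FMS embedding $\widetilde{\mathcal M}\to\mathcal B$ sends $|0\rangle$ to $1$, sends each vector $\varphi_{-i_l}^{n_l}\cdots\varphi_{-i_1}^{n_1}\varphi_{-j_k}^{*\,m_k}\cdots\varphi_{-j_1}^{*\,m_1}|0\rangle$ ($i_l>\dots>i_1\ge1$, $j_k>\dots>j_1\ge0$) to the result of applying the corresponding operators on $\mathcal B$ to $1$, and is extended to infinite linear combinations of these vectors coefficientwise. Define the elementary Schur polynomials $S_k(-x-y)$, $k\ge0$, by $\sum_{k\ge0}S_k(-x-y)w^k=\exp\big(-\sum_{n\ge1}(x_n+y_n)w^n\big)$. **Theorem.** Let $s\ge0$ be an integer and $a_1,\dots,a_s\in\mathbb C$. Then $$\exp\Big(\sum_{j=1}^s a_j\varphi_{-j}\varphi^*_0\Big)\cdot 1=\frac{1}{1-\sum_{j=1}^s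 a_jS_j(-x-y)}\exp\left(-\sum_{n\ge1}x_n\left(\frac{-\sum_{j=1}^s a_jS_{j-1}(-x-y)}{1-\sum_{j=1}^s a_jS_j(-x-y)}\right)^{n}\right)$$ in $\mathcal B$. Here the left side is the sum $\sum_{k\ge0}\frac1{k!}\big(\sum_{j=1}^s a_j\varphi_{-j}\varphi^*_0\big)^k\cdot1$, in which every monomial in $x,y,p^{\pm1}$ occurs in only finitely many terms; and the right side, an element of $\mathbb C[[x,y]]$ placed in the $p^0$-component, is also the image under the FMS embedding of the vector $\exp\big(\sum_{j=1}^s a_j\varphi_{-j}\varphi^*_0\big)|0\rangle\in\widetilde{\mathcal M}$. -/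

import Mathlib

open scoped Nat

noncomputable section

namespace FMS

/-! ### Locally finite sums of formal power series -/

/-- The coefficientwise sum of a family of power series.  It is only used for families in which
every monomial occurs in finitely many members. -/
def formalSum {ι σ : Type} (u : ι → MvPowerSeries σ ℂ) : MvPowerSeries σ ℂ :=
  fun d => ∑ᶠ i, MvPowerSeries.coeff d (u i)

/-- `exp g = ∑ₖ gᵏ / k!` for a power series `g` without constant term. -/
def formalExp {σ : Type} (g : MvPowerSeries σ ℂ) : MvPowerSeries σ ℂ :=
  formalSum fun k : ℕ => ((k ! : ℂ)⁻¹) • g ^ k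

/-! ### Elementary Schur polynomials -/

/-- The series `∑_{n ≥ 1} tₙ zⁿ`. -/
def positiveSeries {R : Type} [Ring R] (t : ℕ+ → R) : PowerSeries R :=
  PowerSeries.mk fun n => if h : 0 < n then t ⟨n, h⟩ else 0

/-- `elemSchur t k = Sₖ(t)` is the coefficient of `zᵏ` in `exp (∑_{n ≥ 1} tₙ zⁿ)`; the powers
`(∑ tₙ zⁿ)ᵐ` with `m > k` do not contribute to this coefficient.  The ring `R` need not be
commutative, so that the definition also applies to (commuting) operators `tₙ`. -/
def elemSchur {R : Type} [Ring R] [Algebra ℂ R] (t : ℕ+ → R) (k : ℕ) : R :=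
  ∑ m ∈ Finset.range (k + 1), ((m ! : ℂ)⁻¹) • PowerSeries.coeff k (positiveSeries t ^ m)

/-! ### The bosonic Fock space `ℂ[[x, y; p, p⁻¹]]` -/

/-- Indices of the variables: `Sum.inl n` stands for `xₙ`, `Sum.inr n` for `yₙ` (`n ≥ 1`). -/
abbrev Var : Type := ℕ+ ⊕ ℕ+

/-- The ring `ℂ[[x, y]]`. -/
abbrev XY : Type := MvPowerSeries Var ℂ

/-- The space `ℂ[[x, y; p, p⁻¹]]`: `F l` is the coefficient of `pˡ` in `F`. -/
abbrev Boson : Type := ℤ → XY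

def x (n : ℕ+) : XY := MvPowerSeries.X (Sum.inl n)

def y (n : ℕ+) : XY := MvPowerSeries.X (Sum.inr n)

/-- A power series in `x, y`, viewed in the `p⁰`-component. -/
def ofXY (f : XY) : Boson := Pi.single 0 f

/-- The vector `1`. -/
def vac : Boson := ofXY 1

/-- Coefficientwise sum of a (locally finite) family. -/
def bosonSum {ι : Type} (u : ι → Boson) : Boson := fun l => formalSum fun i => u i l

/-- The family `u` is locally finite (every monomial `x^α y^β pˡ` occurs in finitely many of
the `u i`) and its coefficientwise sum is `F`. -/
def HasBosonSum {ι : Type} (u : ι → Boson) (F : Boson) : Prop :=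
  (∀ (l : ℤ) (d : Var →₀ ℕ), {i | MvPowerSeries.coeff d (u i l) ≠ 0}.Finite) ∧ bosonSum u = F

/-- Multiplication by `pᵐ`. -/
def mulP (m : ℤ) (F : Boson) : Boson := fun l => F (l - m)

/-- The operator `p ∂/∂p`. -/
def pDp : Module.End ℂ Boson where
  toFun F := fun l => (l : ℂ) • F l
  map_add' F G := by funext l; simp
  map_smul' c F := by funext l; exact smul_comm (l : ℂ) c (F l)

/-- The partial derivative with respect to the variable `v`. -/
def partialD (v : Var) : Module.End ℂ Boson where
  toFun F := fun l => MvPowerSeries.pderiv ℂ v (F l)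
  map_add' F G := by funext l; simp
  map_smul' c F := by funext l; simp

/-- Multiplication by a power series in `x, y`. -/
def mulXY (f : XY) : Module.End ℂ Boson where
  toFun F := fun l => f * F l
  map_add' F G := by funext l; simp [mul_add]
  map_smul' c F := by funext l; simp

/-- The modes of the Heisenberg field `α(z) = ∑ₙ αₙ z^(-n-1)`:
`αₙ = ∂/∂xₙ` and `α₋ₙ = n xₙ` for `n > 0`, and `α₀ = p ∂/∂p`. -/
def alpha : ℤ → Module.End ℂ Boson
  | Int.ofNat 0 => pDp
  | Int.ofNat (k + 1) => partialD (Sum.inl k.succPNat)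
  | Int.negSucc k => mulXY (((k + 1 : ℕ) : ℂ) • x k.succPNat)

/-- The operator `(∂/∂xₙ - ∂/∂yₙ) / n`. -/
def diffD (n : ℕ+) : Module.End ℂ Boson :=
  ((n : ℕ) : ℂ)⁻¹ • (partialD (Sum.inl n) - partialD (Sum.inr n))

/-- `φᵢ`, the coefficient of `z^(-i-1)` in
`φ(z) = p⁻¹ exp(-∑ₙ (xₙ + yₙ) zⁿ) exp(∑ₙ (∂/∂xₙ - ∂/∂yₙ) z⁻ⁿ / n)`.
The pair `(a, b)` takes `zᵃ` from the first exponential and `z⁻ᵇ` from the second.  As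
`S_a(-x-y)` is homogeneous of weight `a` (where `xₙ`, `yₙ` have weight `n`), the family is
locally finite. -/
def phi (i : ℤ) (F : Boson) : Boson :=
  mulP (-1) (bosonSum fun q : ℕ × ℕ =>
    if (q.1 : ℤ) - q.2 = -i - 1 then
      mulXY (elemSchur (fun n => -x n - y n) q.1) (elemSchur diffD q.2 F)
    else 0)

/-- `φ*ᵢ`, the coefficient of `z⁻ⁱ` in
`φ*(z) = p exp(∑ₙ (xₙ + yₙ) zⁿ) α(z) exp(-∑ₙ (∂/∂xₙ - ∂/∂yₙ) z⁻ⁿ / n)`.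
The triple `(a, n, b)` takes `zᵃ` from the first exponential, `αₙ z^(-n-1)` from `α(z)` and
`z⁻ᵇ` from the second exponential.  Again the family is locally finite, by weights. -/
def phiStar (i : ℤ) (F : Boson) : Boson :=
  mulP 1 (bosonSum fun q : ℕ × ℤ × ℕ =>
    if (q.1 : ℤ) + (-q.2.1 - 1) - q.2.2 = -i then
      mulXY (elemSchur (fun n => x n + y n) q.1)
        (alpha q.2.1 (elemSchur (fun n => -diffD n) q.2.2 F))
    else 0)

/-! ### The completed Fock space of the charged free bosons and its embedding -/

/-- Indices of the creation operators: `Sum.inl i` stands for `φ₋ᵢ` (`i ≥ 1`) and `Sum.inr j`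
for `φ*₋ⱼ` (`j ≥ 0`). -/
abbrev Creation : Type := ℕ+ ⊕ ℕ

/-- The completed Fock space `ℂ[[φ₋ᵢ, φ*₋ⱼ | i ≥ 1, j ≥ 0]]|0⟩`.  The vacuum `|0⟩` is `1`, and the
creation operators act by multiplication by the corresponding variables. -/
abbrev Fock : Type := MvPowerSeries Creation ℂ

/-- The image in `ℂ[[x, y; p, p⁻¹]]` of the basis vector
`φ₋ᵢₗ^(nₗ) ⋯ φ₋ᵢ₁^(n₁) φ*₋ⱼₖ^(mₖ) ⋯ φ*₋ⱼ₁^(m₁) |0⟩`, where `iₗ > ⋯ > i₁ ≥ 1`, `jₖ > ⋯ > j₁ ≥ 0`,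
obtained by applying the operators `φ₋ᵢ`, `φ*₋ⱼ` to `1` in this order. -/
def fmsMonomial (d : Creation →₀ ℕ) : Boson :=
  ((Finsupp.sumFinsuppEquivProdFinsupp d).1.support.sort (fun i j => j ≤ i)).foldr
    (fun (i : ℕ+) (F : Boson) => (phi (-((i : ℕ) : ℤ)))^[d (Sum.inl i)] F)
    (((Finsupp.sumFinsuppEquivProdFinsupp d).2.support.sort (fun i j => j ≤ i)).foldr
      (fun (j : ℕ) (F : Boson) => (phiStar (-(j : ℤ)))^[d (Sum.inr j)] F) vac)

/-- The FMS embedding of the completed Fock space into `ℂ[[x, y; p, p⁻¹]]`: the extension of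
`fmsMonomial` to infinite linear combinations of basis vectors.  These sums are locally finite,
because there are only finitely many basis vectors of given charge and degree. -/
def fms (f : Fock) : Boson :=
  bosonSum fun d : Creation →₀ ℕ => MvPowerSeries.coeff d f • fmsMonomial d

/-! ### The two sides of the formula -/

/-- The operator `∑_{j=1}^s aⱼ φ₋ⱼ φ*₀` on `ℂ[[x, y; p, p⁻¹]]`. -/
def expOp (s : ℕ) (a : ℕ → ℂ) (F : Boson) : Boson :=
  ∑ j ∈ Finset.Icc 1 s, a j • phi (-(j : ℤ)) (phiStar 0 F)

/-- The vector `exp(∑_{j=1}^s aⱼ φ₋ⱼ φ*₀)|0⟩` of the completed Fock space. -/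
def fockTau (s : ℕ) (a : ℕ → ℂ) : Fock :=
  formalExp (∑ j : Fin s, a (j + 1) •
    (MvPowerSeries.X (Sum.inl (j : ℕ).succPNat) * MvPowerSeries.X (Sum.inr 0) : Fock))

/-- `∑_{j=1}^s aⱼ Sⱼ(-x-y)`. -/
def schurQ (s : ℕ) (a : ℕ → ℂ) : XY :=
  ∑ j ∈ Finset.Icc 1 s, a j • elemSchur (fun n => -x n - y n) j

/-- `∑_{j=1}^s aⱼ Sⱼ₋₁(-x-y)`. -/
def schurP (s : ℕ) (a : ℕ → ℂ) : XY :=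
  ∑ j ∈ Finset.Icc 1 s, a j • elemSchur (fun n => -x n - y n) (j - 1)

/-- `1/(1-Q) · exp(-∑_{n ≥ 1} xₙ (-P/(1-Q))ⁿ)`, with `Q = schurQ s a` and `P = schurP s a`.
The series `1 - Q` has constant term `1`, so `⁻¹` is the inverse in `ℂ[[x, y]]`. -/
def tauFormula (s : ℕ) (a : ℕ → ℂ) : XY :=
  (1 - schurQ s a)⁻¹ *
    formalExp (-formalSum fun n : ℕ+ => x n * (-schurP s a * (1 - schurQ s a)⁻¹) ^ (n : ℕ))

end FMS

end

/-! Put E(u) = exp(-∑ xₙ(-u)ⁿ) (`elemSeries`). All vectors that occur are modes p^l [u^k] M(u)E(u)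
(`mode l k M`), and on them the two fields become elementary operators in the auxiliary variable u.

If M is killed by all ∂/∂xₙ - ∂/∂yₙ, this difference acts on M·E as multiplication by -(-u)ⁿ. Hence
exp(∑(∂/∂xₙ - ∂/∂yₙ)z⁻ⁿ/n) acts as 1 + u/z, and its inverse as 1/(1 + u/z). So φ₋ⱼ lowers the
p-degree by 1 and multiplies M by S_{j-1}(-x-y) + Sⱼ(-x-y)u (`phi_mode`). On a mode p^{k-m}[u^k]
whose M is a combination of products of m such factors, φ*₀ raises the p-degree by 1 and acts as
∂/∂u, that is, k becomes k + 1 with a factor k + 1 (`phiStar_mode`). The input is a first order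
identity for M (`IsEuler`), which is multiplicative and is checked on a single factor
(`isEuler_schurPair`).

With P = `schurP`, Q = `schurQ` it follows that the k-th power of the exponent sends 1 to k! [u^k](P
+ Qu)^k E(u) (`expOp_iterate_vac`). Writing eᵢ for the coefficients of E, the sum over k is ∑
binom(i+m, i) PⁱQᵐeᵢ = (1-Q)⁻¹ E(P/(1-Q)), which is the formula (`tauFormula_eq_formalSum`). All
sums are locally finite because the k-th term has weight at least k when xₙ, yₙ have weight n;
identities between them are checked modulo each weight.

For the Fock space vector, φ*₀^k·1 = k! p^k[u^k]E, and each φ₋ⱼ then multiplies by its factor. The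
multinomial expansion of the exponential therefore reassembles the same modes (`sum_fockExponents`).
-/

noncomputable section

namespace FMS

open PowerSeries Finset

/-! ### Generating series of elementary Schur polynomials -/

/-- The generating series `∑ₖ Sₖ(t) uᵏ`. -/
def schurSeries {R : Type} [Ring R] [Algebra ℂ R] (t : ℕ+ → R) : R⟦X⟧ := mk (elemSchur t)

@[simp] lemma coeff_schurSeries {R : Type} [Ring R] [Algebra ℂ R] (t : ℕ+ → R) (k : ℕ) :
    coeff k (schurSeries t) = elemSchur t k := coeff_mk _ _

lemma elemSchur_zero {R : Type} [Ring R] [Algebra ℂ R] (t : ℕ+ → R) : elemSchur t 0 = 1 := by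
  simp [elemSchur]

lemma coeff_positiveSeries_zero {R : Type} [Ring R] (t : ℕ+ → R) :
    coeff 0 (positiveSeries t) = 0 := by
  simp [positiveSeries]

lemma coeff_positiveSeries_succ {R : Type} [Ring R] (t : ℕ+ → R) (k : ℕ) :
    coeff (k + 1) (positiveSeries t) = t k.succPNat := by
  simp [positiveSeries, Nat.succPNat]

/-- The derivation of `R⟦X⟧` which applies a derivation of `R` to each coefficient. -/
def coeffDeriv {R : Type} [CommRing R] [Algebra ℂ R] (δ : Derivation ℂ R R) :
    Derivation ℂ R⟦X⟧ R⟦X⟧ :=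
  Derivation.mk'
    { toFun := fun F => mk fun k => δ (coeff k F)
      map_add' := fun F G => by ext k; simp
      map_smul' := fun c F => by ext k; simp }
    (fun F G => by
      ext k
      simp only [LinearMap.coe_mk, AddHom.coe_mk, coeff_mk, coeff_mul, map_sum, Derivation.leibniz,
        smul_eq_mul, map_add, sum_add_distrib]
      congr 1
      rw [← Nat.sum_antidiagonal_swap]
      rfl)

section Comm

variable {R : Type} [CommRing R] [Algebra ℂ R]

@[simp] lemma coeff_coeffDeriv (δ : Derivation ℂ R R) (F : R⟦X⟧) (k : ℕ) :
    coeff k (coeffDeriv δ F) = δ (coeff k F) :=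
  coeff_mk k fun k => δ (coeff k F)

omit [Algebra ℂ R] in
lemma coeff_positiveSeries_pow_of_lt (t : ℕ+ → R) {k m : ℕ} (h : k < m) :
    coeff k (positiveSeries t ^ m) = 0 :=
  by
  have hX : (X : R⟦X⟧) ∣ positiveSeries t := X_dvd_iff.2 (by simpa using coeff_positiveSeries_zero t)
  exact X_pow_dvd_iff.1 (pow_dvd_pow_of_dvd hX m) k h

lemma elemSchur_eq_sum_range (t : ℕ+ → R) {k n : ℕ} (h : k < n) :
    elemSchur t k = ∑ m ∈ range n, ((m ! : ℂ)⁻¹) • coeff k (positiveSeries t ^ m) := by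
  refine sum_subset (range_mono h) fun m _ hm => ?_
  rw [coeff_positiveSeries_pow_of_lt t (by simpa using hm), smul_zero]

/-- A derivation of `R⟦X⟧` which acts on coefficients, with a degree shift of at most `1`, satisfies
the chain rule on the exponential series `schurSeries t`. -/
lemma derivation_schurSeries (Δ : Derivation ℂ R⟦X⟧ R⟦X⟧) (ε : ℕ → R →ₗ[ℂ] R) (i : ℕ → ℕ)
    (hi : ∀ k, i k ≤ k + 1) (hΔ : ∀ k F, coeff k (Δ F) = ε k (coeff (i k) F)) (t : ℕ+ → R) :
    Δ (schurSeries t) = Δ (positiveSeries t) * schurSeries t := by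
  ext k
  have hfac (m : ℕ) : (((m + 1)! : ℂ)⁻¹) * ((m + 1 : ℕ) : ℂ) = (m ! : ℂ)⁻¹ := by
    rw [Nat.factorial_succ]; push_cast
    have : (m ! : ℂ) ≠ 0 := by exact_mod_cast m.factorial_ne_zero
    field_simp
  have hpow (m : ℕ) : (((m + 1)! : ℂ)⁻¹) • coeff k (Δ (positiveSeries t ^ (m + 1))) =
      ((m ! : ℂ)⁻¹) • coeff k (Δ (positiveSeries t) * positiveSeries t ^ m) := by
    rw [Derivation.leibniz_pow, ← hfac m, mul_smul, Nat.cast_smul_eq_nsmul, ← map_nsmul,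
      Nat.add_sub_cancel, smul_eq_mul, mul_comm (Δ _)]
  -- `Δ` reads coefficients up to degree k + 1, so k + 2 powers suffice. The power m = 0 is killed
  -- by `Δ`, and the remaining k + 1 match the truncation on the right.
  rw [hΔ, coeff_schurSeries, elemSchur_eq_sum_range t (n := k + 2) (by have := hi k; omega), map_sum,
    sum_range_succ']
  simp only [map_smul, ← hΔ, hpow]
  simp only [pow_zero, Derivation.map_one_eq_zero, map_zero, smul_zero, add_zero, coeff_mul, smul_sum]
  rw [sum_comm]
  refine sum_congr rfl fun p hp => ?_
  rw [coeff_schurSeries, elemSchur_eq_sum_range t (n := k + 1)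
    (by have := mem_antidiagonal.1 hp; omega), mul_sum]
  simp only [mul_smul_comm]

lemma coeffDeriv_schurSeries (δ : Derivation ℂ R R) (t : ℕ+ → R) :
    coeffDeriv δ (schurSeries t) = coeffDeriv δ (positiveSeries t) * schurSeries t :=
  derivation_schurSeries (coeffDeriv δ) (fun _ => δ.toLinearMap) id (by simp) (by simp) t

lemma derivative_schurSeries (t : ℕ+ → R) :
    derivative R (schurSeries t) = derivative R (positiveSeries t) * schurSeries t :=
  derivation_schurSeries ((derivative R).restrictScalars ℂ)
    (fun k => ((k + 1 : ℂ)) • LinearMap.id) (fun k => k + 1) (by simp)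
    (fun k F => by
      simp [coeff_derivative, Algebra.smul_def]; ring) t

omit [Algebra ℂ R] in
lemma coeff_derivative_positiveSeries (t : ℕ+ → R) (n : ℕ) :
    coeff n (derivative R (positiveSeries t)) = (n + 1) * t n.succPNat := by
  rw [coeff_derivative, coeff_positiveSeries_succ, mul_comm]

lemma elemSchur_succ_of_comm (t : ℕ+ → R) (k : ℕ) :
    ((k + 1 : ℕ) : ℂ) • elemSchur t (k + 1) =
      ∑ n ∈ range (k + 1), ((n + 1 : ℕ) : ℂ) • (elemSchur t (k - n) * t n.succPNat) := by
  have h := congrArg (coeff k) (derivative_schurSeries t)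
  rw [coeff_derivative, coeff_mul, Nat.sum_antidiagonal_eq_sum_range_succ_mk] at h
  simp only [coeff_derivative_positiveSeries, coeff_schurSeries] at h
  simp only [Nat.cast_smul_eq_nsmul, nsmul_eq_mul]
  push_cast
  rw [mul_comm, h]
  exact sum_congr rfl fun n _ => by ring

/-- A power series is determined by a first order linear differential equation. -/
lemma eq_zero_of_derivative_eq_mul {F H : R⟦X⟧} (h : derivative R F = H * F)
    (h0 : coeff 0 F = 0) : F = 0 := by
  ext k
  induction k using Nat.strong_induction_on with
  | _ k ih =>
    rcases k with _ | k
    · simpa using h0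
    have hk := congrArg (coeff k) h
    rw [coeff_derivative, coeff_mul, sum_eq_zero] at hk
    · have : ((k + 1 : ℕ) : ℂ) • coeff (k + 1) F = 0 := by
        rw [Nat.cast_smul_eq_nsmul, nsmul_eq_mul, mul_comm]; exact_mod_cast hk
      simpa [Nat.cast_add_one_ne_zero] using (smul_eq_zero_iff_right (by exact_mod_cast k.succ_ne_zero)).1 this
    · intro p hp
      rw [ih p.2 (by have := mem_antidiagonal.1 hp; omega)]; simp

lemma schurSeries_neg_mul (t : ℕ+ → R) :
    schurSeries (fun n => -t n) * schurSeries t = 1 := by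
  have hneg : positiveSeries (fun n => -t n) = -positiveSeries t := by
    ext k
    rcases k with _ | k
    · rw [map_neg, coeff_positiveSeries_zero, coeff_positiveSeries_zero, neg_zero]
    · rw [map_neg, coeff_positiveSeries_succ, coeff_positiveSeries_succ]
  -- The product has logarithmic derivative zero and constant term 1.
  refine sub_eq_zero.1 (eq_zero_of_derivative_eq_mul (H := 0) ?_ ?_)
  · rw [map_sub, Derivation.leibniz, derivative_schurSeries, derivative_schurSeries, hneg, map_neg]
    simp only [smul_eq_mul, Derivation.map_one_eq_zero]
    ring
  · simp only [map_sub, coeff_mul, Nat.antidiagonal_zero, sum_singleton, coeff_schurSeries,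
      elemSchur_zero, coeff_zero_one]; ring

lemma elemSchur_map {S : Type} [Ring S] [Algebra ℂ S] (f : R →ₐ[ℂ] S) (t : ℕ+ → R) (k : ℕ) :
    elemSchur (fun n => f (t n)) k = f (elemSchur t k) := by
  have h : positiveSeries (fun n => f (t n)) = PowerSeries.map (f : R →+* S) (positiveSeries t) := by
    ext k
    rw [coeff_map]
    rcases k with _ | k
    · rw [coeff_positiveSeries_zero, coeff_positiveSeries_zero, map_zero]
    · rw [coeff_positiveSeries_succ, coeff_positiveSeries_succ]; rfl
  simp only [elemSchur, h, ← map_pow, coeff_map, map_sum, map_smul]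
  rfl

lemma elemSchur_rescale (c : R) (t : ℕ+ → R) (k : ℕ) :
    elemSchur (fun n => c ^ (n : ℕ) * t n) k = c ^ k * elemSchur t k := by
  have h : positiveSeries (fun n => c ^ (n : ℕ) * t n) = rescale c (positiveSeries t) := by
    ext k
    rw [coeff_rescale]
    rcases k with _ | k
    · rw [coeff_positiveSeries_zero, coeff_positiveSeries_zero, mul_zero]
    · rw [coeff_positiveSeries_succ, coeff_positiveSeries_succ]; rfl
  simp only [elemSchur, h, ← map_pow, coeff_rescale, mul_sum, mul_smul_comm]

end Comm

/-- The recursion for elementary Schur polynomials in commuting elements. -/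
lemma elemSchur_succ {R : Type} [Ring R] [Algebra ℂ R] (t : ℕ+ → R)
    (ht : ∀ m n, t m * t n = t n * t m) (k : ℕ) :
    ((k + 1 : ℕ) : ℂ) • elemSchur t (k + 1) =
      ∑ n ∈ range (k + 1), ((n + 1 : ℕ) : ℂ) • (elemSchur t (k - n) * t n.succPNat) := by
  have hc : ∀ a ∈ Set.range t, ∀ b ∈ Set.range t, a * b = b * a := by
    rintro _ ⟨m, rfl⟩ _ ⟨n, rfl⟩; exact ht m n
  -- The tₙ generate a commutative subalgebra, where the commutative recursion holds; its inclusion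
  -- carries the recursion back to `R`.
  have := Algebra.isMulCommutative_adjoin ℂ hc
  let A := Algebra.adjoin ℂ (Set.range t)
  let : CommRing A := { (inferInstance : Ring A) with mul_comm := fun a b => mul_comm' a b }
  let u : ℕ+ → A := fun n => ⟨t n, Algebra.subset_adjoin ⟨n, rfl⟩⟩
  have hu (k : ℕ) : elemSchur t k = A.val (elemSchur u k) := elemSchur_map A.val u k
  have h := congrArg A.val (elemSchur_succ_of_comm u k)
  simp only [map_smul, map_sum, map_mul, ← hu] at h
  exact h

/-! ### The weight filtration of `ℂ[[x, y]]` -/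

/-- The weight of a monomial, where `xₙ` and `yₙ` have weight `n`. -/
def weight : (Var →₀ ℕ) →+ ℕ :=
  Finsupp.weight (Sum.elim (fun n : ℕ+ => (n : ℕ)) fun n : ℕ+ => (n : ℕ))

/-- The ideal of power series all of whose monomials have weight at least `n`. -/
def weightIdeal (n : ℕ) : Ideal XY where
  carrier := {f | ∀ d, weight d < n → MvPowerSeries.coeff d f = 0}
  zero_mem' := fun _ _ => by simp
  add_mem' := fun hf hg d hd => by rw [map_add, hf d hd, hg d hd, add_zero]
  smul_mem' := fun c f hf d hd => by
    classical
    rw [smul_eq_mul, MvPowerSeries.coeff_mul]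
    refine sum_eq_zero fun p hp => ?_
    rw [hf p.2, mul_zero]
    have := congrArg weight (mem_antidiagonal.1 hp)
    rw [map_add] at this
    omega

lemma mem_weightIdeal {n : ℕ} {f : XY} :
    f ∈ weightIdeal n ↔ ∀ d, weight d < n → MvPowerSeries.coeff d f = 0 := Iff.rfl

lemma weightIdeal_anti {m n : ℕ} (h : m ≤ n) {f : XY} (hf : f ∈ weightIdeal n) :
    f ∈ weightIdeal m := fun d hd => hf d (by omega)

lemma mem_weightIdeal_zero (f : XY) : f ∈ weightIdeal 0 := fun _ h => absurd h (Nat.not_lt_zero _)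

lemma smul_mem_weightIdeal {n : ℕ} (c : ℂ) {f : XY} (hf : f ∈ weightIdeal n) :
    c • f ∈ weightIdeal n := fun d hd => by
  rw [map_smul, hf d hd, smul_zero]

lemma mul_mem_weightIdeal {m n : ℕ} {f g : XY} (hf : f ∈ weightIdeal m) (hg : g ∈ weightIdeal n) :
    f * g ∈ weightIdeal (m + n) := fun d hd => by
  classical
  rw [MvPowerSeries.coeff_mul]
  refine sum_eq_zero fun p hp => ?_
  have := congrArg weight (mem_antidiagonal.1 hp)
  rw [map_add] at this
  rcases lt_or_ge (weight p.1) m with h | h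
  · rw [hf p.1 h, zero_mul]
  · rw [hg p.2 (by omega), mul_zero]

lemma pow_mem_weightIdeal {n : ℕ} {f : XY} (hf : f ∈ weightIdeal n) (k : ℕ) :
    f ^ k ∈ weightIdeal (n * k) := by
  induction k with
  | zero => exact mem_weightIdeal_zero _
  | succ k ih => rw [pow_succ, mul_add_one]; exact mul_mem_weightIdeal ih hf

lemma weight_single (v : Var) :
    weight (Finsupp.single v 1) = Sum.elim (fun n : ℕ+ => (n : ℕ)) (fun n : ℕ+ => (n : ℕ)) v := by
  simp [weight, Finsupp.weight_apply]

lemma X_mem_weightIdeal (v : Var) :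
    (MvPowerSeries.X v : XY) ∈
      weightIdeal (Sum.elim (fun n : ℕ+ => (n : ℕ)) (fun n : ℕ+ => (n : ℕ)) v) := fun d hd => by
  classical
  rw [MvPowerSeries.coeff_X, if_neg]
  rintro rfl
  rw [weight_single] at hd
  exact lt_irrefl _ hd

lemma x_mem_weightIdeal (n : ℕ+) : x n ∈ weightIdeal n := X_mem_weightIdeal (Sum.inl n)

lemma y_mem_weightIdeal (n : ℕ+) : y n ∈ weightIdeal n := X_mem_weightIdeal (Sum.inr n)

lemma constantCoeff_eq_zero {f : XY} (hf : f ∈ weightIdeal 1) :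
    MvPowerSeries.constantCoeff f = 0 := by
  rw [← MvPowerSeries.coeff_zero_eq_constantCoeff_apply]
  exact hf 0 (by simp)

/-- Reduction modulo the power series of weight at least `n`. -/
abbrev weightMk (n : ℕ) : XY →ₐ[ℂ] XY ⧸ weightIdeal n := Ideal.Quotient.mkₐ ℂ (weightIdeal n)

lemma weightMk_eq {n : ℕ} {f g : XY} : weightMk n f = weightMk n g ↔ f - g ∈ weightIdeal n :=
  Ideal.Quotient.eq

lemma weightMk_eq_iff {n : ℕ} {f g : XY} : weightMk n f = weightMk n g ↔
    ∀ d, weight d < n → MvPowerSeries.coeff d f = MvPowerSeries.coeff d g := by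
  rw [weightMk_eq, mem_weightIdeal]
  simp only [map_sub, sub_eq_zero]

lemma weightMk_eq_zero {n : ℕ} {f : XY} (hf : f ∈ weightIdeal n) : weightMk n f = 0 :=
  Ideal.Quotient.eq_zero_iff_mem.2 hf

lemma eq_of_weightMk_eq {f g : XY} (h : ∀ n, weightMk n f = weightMk n g) : f = g := by
  ext d
  exact weightMk_eq_iff.1 (h (weight d + 1)) d (by omega)

/-! ### Locally finite sums -/

lemma weightMk_formalSum {ι : Type} {u : ι → XY} {n : ℕ} (s : Finset ι)
    (hu : ∀ i ∉ s, u i ∈ weightIdeal n) :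
    weightMk n (formalSum u) = ∑ i ∈ s, weightMk n (u i) := by
  rw [← map_sum, weightMk_eq_iff]
  intro d hd
  rw [map_sum]
  refine finsum_eq_sum_of_support_subset _ fun i hi => ?_
  by_contra h
  exact hi (hu i h d hd)

lemma weightMk_formalSum_nat {u : ℕ → XY} (hu : ∀ k, u k ∈ weightIdeal k) (n : ℕ) :
    weightMk n (formalSum u) = ∑ k ∈ range n, weightMk n (u k) :=
  weightMk_formalSum _ fun k hk => weightIdeal_anti (by simpa using hk) (hu k)

lemma formalSum_neg {ι σ : Type} (u : ι → MvPowerSeries σ ℂ) :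
    formalSum (fun i => -u i) = -formalSum u := by
  ext d
  change ∑ᶠ i, MvPowerSeries.coeff d (-u i) = -∑ᶠ i, MvPowerSeries.coeff d (u i)
  simp only [map_neg, finsum_neg_distrib]

lemma weightMk_sum_antidiagonal (f : ℕ × ℕ → XY) (hf : ∀ p, f p ∈ weightIdeal (p.1 + p.2))
    (n : ℕ) : ∑ k ∈ range n, ∑ p ∈ antidiagonal k, weightMk n (f p) =
      ∑ i ∈ range n, ∑ j ∈ range n, weightMk n (f (i, j)) := by
  -- The square splits into the triangle i + j < n, which is fibred by k = i + j, and a rest that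
  -- vanishes modulo weight n.
  rw [← sum_product', ← sum_filter_add_sum_filter_not (range n ×ˢ range n) fun p => p.1 + p.2 < n,
    sum_eq_zero (s := {p ∈ range n ×ˢ range n | ¬p.1 + p.2 < n}), add_zero,
    ← sum_fiberwise_of_maps_to (t := range n) (g := fun p : ℕ × ℕ => p.1 + p.2)]
  · refine sum_congr rfl fun k hk => sum_congr ?_ fun _ _ => rfl
    ext p
    simp only [HasAntidiagonal.mem_antidiagonal, mem_filter, mem_product, mem_range] at hk ⊢
    omega
  · intro p hp
    simpa using (mem_filter.1 hp).2
  · intro p hp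
    exact weightMk_eq_zero (weightIdeal_anti (not_lt.1 (mem_filter.1 hp).2) (hf p))

/-! ### Graded power series -/

/-- The coefficient of `uᵏ` has weight at least `k`. -/
def IsGraded (F : XY⟦X⟧) : Prop := ∀ k, coeff k F ∈ weightIdeal k

lemma isGraded_one : IsGraded 1 := fun k => by
  rcases k with _ | k
  · exact mem_weightIdeal_zero _
  · rw [coeff_one, if_neg (by omega)]; exact zero_mem _

lemma IsGraded.mul {F G : XY⟦X⟧} (hF : IsGraded F) (hG : IsGraded G) : IsGraded (F * G) := fun k => by
  rw [coeff_mul]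
  refine sum_mem fun p hp => ?_
  rw [← mem_antidiagonal.1 hp]
  exact mul_mem_weightIdeal (hF p.1) (hG p.2)

lemma IsGraded.pow {F : XY⟦X⟧} (hF : IsGraded F) (n : ℕ) : IsGraded (F ^ n) := by
  induction n with
  | zero => rw [pow_zero]; exact isGraded_one
  | succ n ih => rw [pow_succ]; exact ih.mul hF

lemma isGraded_prod {ι : Type} (s : Finset ι) {F : ι → XY⟦X⟧} (hF : ∀ i ∈ s, IsGraded (F i)) :
    IsGraded (∏ i ∈ s, F i) := by
  classical
  induction s using Finset.induction_on with
  | empty => rw [prod_empty]; exact isGraded_one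
  | insert i s hi ih =>
    rw [prod_insert hi]
    exact (hF i (mem_insert_self _ _)).mul (ih fun j hj => hF j (mem_insert_of_mem hj))

lemma isGraded_positiveSeries {t : ℕ+ → XY} (ht : ∀ n : ℕ+, t n ∈ weightIdeal n) :
    IsGraded (positiveSeries t) := fun k => by
  rcases k with _ | k
  · exact mem_weightIdeal_zero _
  · rw [coeff_positiveSeries_succ]; simpa using ht k.succPNat

lemma elemSchur_mem_weightIdeal {t : ℕ+ → XY} (ht : ∀ n : ℕ+, t n ∈ weightIdeal n) (k : ℕ) :
    elemSchur t k ∈ weightIdeal k :=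
  sum_mem fun m _ => smul_mem_weightIdeal _ ((isGraded_positiveSeries ht).pow m k)

lemma isGraded_schurSeries {t : ℕ+ → XY} (ht : ∀ n : ℕ+, t n ∈ weightIdeal n) :
    IsGraded (schurSeries t) := fun k => by
  rw [coeff_schurSeries]; exact elemSchur_mem_weightIdeal ht k

/-- Evaluation of graded power series at `u = 1`, modulo weight at least `n`. -/
def evalOne (n : ℕ) (F : XY⟦X⟧) : XY ⧸ weightIdeal n := ∑ k ∈ range n, weightMk n (coeff k F)

lemma evalOne_mul (n : ℕ) {F G : XY⟦X⟧} (hF : IsGraded F) (hG : IsGraded G) :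
    evalOne n (F * G) = evalOne n F * evalOne n G := by
  simp only [evalOne, coeff_mul, map_sum, sum_mul_sum, ← map_mul]
  exact weightMk_sum_antidiagonal (fun p => coeff p.1 F * coeff p.2 G)
    (fun p => mul_mem_weightIdeal (hF _) (hG _)) n

lemma evalOne_one (n : ℕ) : evalOne n 1 = 1 := by
  rcases n with _ | n
  -- Modulo weight 0 the quotient is the zero ring, so the empty sum equals 1.
  · exact (weightMk_eq_iff.2 fun d hd => absurd hd (Nat.not_lt_zero _) :
      weightMk 0 0 = weightMk 0 1).trans (map_one _)
  · rw [evalOne, sum_range_succ', sum_eq_zero]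
    · simp
    · intro k _
      rw [coeff_one, if_neg (by omega), map_zero]

lemma evalOne_pow (n : ℕ) {F : XY⟦X⟧} (hF : IsGraded F) (m : ℕ) :
    evalOne n (F ^ m) = evalOne n F ^ m := by
  induction m with
  | zero => rw [pow_zero, pow_zero, evalOne_one]
  | succ m ih => rw [pow_succ, evalOne_mul n (hF.pow m) hF, ih, pow_succ]

/-- `exp (∑ₙ tₙ) = ∑ₖ Sₖ(t)` when `tₙ` has weight at least `n`. -/
lemma formalExp_formalSum {t : ℕ+ → XY} (ht : ∀ n : ℕ+, t n ∈ weightIdeal n) :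
    formalExp (formalSum t) = formalSum (elemSchur t) := by
  have hsum (n : ℕ) : weightMk n (formalSum t) = evalOne n (positiveSeries t) := by
    rw [weightMk_formalSum ((range (n - 1)).image Nat.succPNat), evalOne,
      sum_image fun _ _ _ _ h => Nat.succPNat_injective h]
    · rcases n with _ | n
      · simp
      · rw [sum_range_succ', coeff_positiveSeries_zero, map_zero, add_zero]
        simp only [coeff_positiveSeries_succ, Nat.add_sub_cancel]
    · intro i hi
      refine weightIdeal_anti ?_ (ht i)
      by_contra! h
      refine hi (mem_image.2 ⟨i.natPred, mem_range.2 ?_, by simp⟩)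
      have := i.natPred_add_one
      omega
  have hone : formalSum t ∈ weightIdeal 1 := by
    rw [← sub_zero (formalSum t), ← weightMk_eq, hsum, map_zero]
    simp [evalOne, coeff_positiveSeries_zero]
  refine eq_of_weightMk_eq fun n => ?_
  rw [formalExp, weightMk_formalSum_nat, weightMk_formalSum_nat]
  -- `evalOne` is multiplicative on graded series, so the powers of ∑ tₙ are the values at u = 1 of
  -- the powers of ∑ tₙuⁿ; exchanging the two finite sums gives the Sₖ.
  · simp only [map_smul, map_pow, hsum, ← evalOne_pow n (isGraded_positiveSeries ht)]
    simp only [evalOne, smul_sum]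
    rw [sum_comm]
    refine sum_congr rfl fun k hk => ?_
    rw [elemSchur_eq_sum_range t (mem_range.1 hk), map_sum]
    simp only [map_smul]
  · exact elemSchur_mem_weightIdeal ht
  · intro k
    simpa using smul_mem_weightIdeal _ (pow_mem_weightIdeal hone k)

/-! ### The basic series -/

/-- `∑ⱼ Sⱼ(-x-y) uʲ`. -/
def schurNeg : XY⟦X⟧ := schurSeries fun n => -x n - y n

/-- `∑ⱼ Sⱼ(x+y) uʲ`. -/
def schurPos : XY⟦X⟧ := schurSeries fun n => x n + y n

/-- `exp (-∑ₙ xₙ (-u)ⁿ)`. -/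
def elemSeries : XY⟦X⟧ := schurSeries fun n => (-1) ^ (n : ℕ) * -x n

/-- `∑ₙ (n+1) xₙ₊₁ (-u)ⁿ`, the logarithmic derivative of `elemSeries`. -/
def logDeriv : XY⟦X⟧ := mk fun n => (n + 1 : XY) * (-1) ^ n * x n.succPNat

/-- `S_{j-1}(-x-y) + Sⱼ(-x-y) u`, for the index `j + 1`. -/
def schurPair (j : ℕ) : XY⟦X⟧ := C (coeff j schurNeg) + C (coeff (j + 1) schurNeg) * X

/-- The derivative with respect to the variable `v`, on each coefficient. -/
abbrev dVar (v : Var) : Derivation ℂ XY⟦X⟧ XY⟦X⟧ := coeffDeriv (MvPowerSeries.pderiv ℂ v)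

lemma schurNeg_mul_schurPos : schurNeg * schurPos = 1 := by
  have h : (fun n => -x n - y n) = fun n => -(x n + y n) := funext fun n => by ring
  rw [schurNeg, h]
  exact schurSeries_neg_mul _

lemma derivative_elemSeries : derivative XY elemSeries = logDeriv * elemSeries := by
  rw [elemSeries, derivative_schurSeries]
  congr 1
  ext1 n
  rw [coeff_derivative_positiveSeries, logDeriv, coeff_mk, Nat.succPNat_coe, Nat.succ_eq_add_one]
  ring

lemma pderiv_x (v : Var) (n : ℕ+) :
    MvPowerSeries.pderiv ℂ v (x n) = if v = Sum.inl n then 1 else 0 := by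
  rw [x, MvPowerSeries.pderiv_X, Pi.single_apply]
  simp only [eq_comm]

lemma pderiv_y (v : Var) (n : ℕ+) :
    MvPowerSeries.pderiv ℂ v (y n) = if v = Sum.inr n then 1 else 0 := by
  rw [y, MvPowerSeries.pderiv_X, Pi.single_apply]
  simp only [eq_comm]

lemma coeffDeriv_positiveSeries (δ : Derivation ℂ XY XY) (t : ℕ+ → XY) (n : ℕ) (c : XY)
    (h : ∀ m, δ (t m) = if m = n.succPNat then c else 0) :
    coeffDeriv δ (positiveSeries t) = C c * X ^ (n + 1) := by
  ext1 k
  rw [coeff_coeffDeriv, coeff_C_mul, coeff_X_pow]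
  rcases k with _ | k
  · rw [coeff_positiveSeries_zero, map_zero, if_neg (by omega), mul_zero]
  · rw [coeff_positiveSeries_succ, h]
    simp [Nat.succPNat_inj]

lemma dVar_inl_schurNeg (n : ℕ) :
    dVar (Sum.inl n.succPNat) schurNeg = -(X ^ (n + 1) * schurNeg) := by
  rw [schurNeg, dVar, coeffDeriv_schurSeries, coeffDeriv_positiveSeries _ _ n (-1)]
  · rw [map_neg, map_one]; ring
  · intro m
    rw [map_sub, map_neg, pderiv_x, pderiv_y]
    simp [eq_comm]
    split_ifs <;> simp

lemma dVar_inr_schurNeg (n : ℕ) :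
    dVar (Sum.inr n.succPNat) schurNeg = -(X ^ (n + 1) * schurNeg) := by
  rw [schurNeg, dVar, coeffDeriv_schurSeries, coeffDeriv_positiveSeries _ _ n (-1)]
  · rw [map_neg, map_one]; ring
  · intro m
    rw [map_sub, map_neg, pderiv_x, pderiv_y]
    simp [eq_comm]
    split_ifs <;> simp

lemma dVar_inl_elemSeries (n : ℕ) :
    dVar (Sum.inl n.succPNat) elemSeries = -((-X) ^ (n + 1) * elemSeries) := by
  rw [elemSeries, dVar, coeffDeriv_schurSeries, coeffDeriv_positiveSeries _ _ n (-(-1) ^ (n + 1))]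
  · rw [map_neg, map_pow, map_neg, map_one, neg_pow X]; ring
  · intro m
    rw [Derivation.leibniz, Derivation.leibniz_pow]
    simp only [map_neg, pderiv_x, Sum.inl.injEq, eq_comm (a := n.succPNat)]
    split_ifs with h
    · simp [h]
    · simp

lemma dVar_inr_elemSeries (n : ℕ) : dVar (Sum.inr n.succPNat) elemSeries = 0 := by
  rw [elemSeries, dVar, coeffDeriv_schurSeries, coeffDeriv_positiveSeries _ _ n 0]
  · simp
  · intro m
    simp [pderiv_x]

/-! ### Operators on the components -/

/-- The series is annihilated by all `∂/∂xₙ - ∂/∂yₙ`. -/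
def IsDiffConst (M : XY⟦X⟧) : Prop :=
  ∀ n : ℕ+, dVar (Sum.inl n) M = dVar (Sum.inr n) M

lemma IsDiffConst.mul {M N : XY⟦X⟧} (hM : IsDiffConst M) (hN : IsDiffConst N) :
    IsDiffConst (M * N) := fun n => by
  rw [Derivation.leibniz, Derivation.leibniz, hM, hN]

lemma isDiffConst_X : IsDiffConst X := fun n => by
  ext1 k
  simp only [coeff_coeffDeriv, coeff_X]
  split_ifs <;> simp

lemma isDiffConst_schurPair (j : ℕ) : IsDiffConst (schurPair j) := fun n => by
  obtain ⟨n, rfl⟩ : ∃ m : ℕ, n = m.succPNat := ⟨n.natPred, by simp⟩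
  have h (k : ℕ) := congrArg (coeff k) ((dVar_inl_schurNeg n).trans (dVar_inr_schurNeg n).symm)
  simp only [coeff_coeffDeriv] at h
  ext1 k
  simp only [coeff_coeffDeriv, schurPair, map_add, coeff_C_mul, coeff_X, coeff_C]
  split_ifs <;> simp [h]

lemma partialD_single (v : Var) (l : ℤ) (f : XY) :
    partialD v (Pi.single l f) = Pi.single l (MvPowerSeries.pderiv ℂ v f) :=
  funext fun i => Pi.apply_single (fun _ => MvPowerSeries.pderiv ℂ v) (fun _ => map_zero _) l f i

lemma mulXY_single (g : XY) (l : ℤ) (f : XY) :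
    mulXY g (Pi.single l f) = Pi.single l (g * f) :=
  funext fun i => Pi.apply_single (fun _ => (g * ·)) (fun _ => mul_zero _) l f i

lemma pDp_single (l : ℤ) (f : XY) : pDp (Pi.single l f) = Pi.single l ((l : ℂ) • f) := by
  funext i
  by_cases h : i = l
  · subst h; simp [pDp]
  · simp [pDp, h]

lemma mulP_single (m l : ℤ) (f : XY) : mulP m (Pi.single l f) = Pi.single (l + m) f := by
  funext i
  simp only [mulP, Pi.single_apply, sub_eq_iff_eq_add]

lemma partialD_comm (v w : Var) : partialD v * partialD w = partialD w * partialD v := by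
  ext1 F
  funext l
  ext d
  simp only [Module.End.mul_apply]
  change MvPowerSeries.coeff d (MvPowerSeries.pderiv ℂ v (MvPowerSeries.pderiv ℂ w (F l))) =
    MvPowerSeries.coeff d (MvPowerSeries.pderiv ℂ w (MvPowerSeries.pderiv ℂ v (F l)))
  simp only [MvPowerSeries.coeff_pderiv]
  rw [add_right_comm]
  by_cases h : v = w
  · rw [h]
  · simp [h, Ne.symm h]
    ring

lemma diffD_comm (m n : ℕ+) : diffD m * diffD n = diffD n * diffD m := by
  simp only [diffD, smul_mul_assoc, mul_smul_comm, sub_mul, mul_sub]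
  simp only [partialD_comm (Sum.inl m), partialD_comm (Sum.inr m)]
  module

/-- The vector `pˡ [uᵏ] (M(u) · elemSeries)`. -/
def mode (l : ℤ) (k : ℕ) : XY⟦X⟧ →ₗ[ℂ] Boson where
  toFun M := Pi.single l (coeff k (M * elemSeries))
  map_add' M N := by rw [add_mul, map_add, Pi.single_add]
  map_smul' c M := by rw [smul_mul_assoc, coeff_smul, RingHom.id_apply, Pi.single_smul]

lemma mode_apply (l : ℤ) (k : ℕ) (M : XY⟦X⟧) :
    mode l k M = Pi.single l (coeff k (M * elemSeries)) := rfl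

lemma mulXY_mode (g : XY) (l : ℤ) (k : ℕ) (M : XY⟦X⟧) :
    mulXY g (mode l k M) = mode l k (C g * M) := by
  rw [mode_apply, mulXY_single, mode_apply, mul_assoc, coeff_C_mul]

lemma mulP_mode (m l : ℤ) (k : ℕ) (M : XY⟦X⟧) : mulP m (mode l k M) = mode (l + m) k M :=
  mulP_single _ _ _

/-- The contributions of M cancel, and of E only the x-derivative is left, which brings down
-(-u)^{n+1}. Scaling by n + 1 removes the denominator in `diffD`. -/
lemma diffD_mode {M : XY⟦X⟧} (hM : IsDiffConst M) (n : ℕ) (l : ℤ) (k : ℕ) :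
    ((n + 1 : ℕ) : ℂ) • diffD n.succPNat (mode l k M) = mode l k (-((-X) ^ (n + 1) * M)) := by
  rw [diffD, LinearMap.smul_apply, smul_smul, Nat.succPNat_coe, mul_inv_cancel₀
    (by exact_mod_cast n.succ_ne_zero), one_smul, LinearMap.sub_apply, mode_apply, partialD_single,
    partialD_single, ← Pi.single_sub, ← coeff_coeffDeriv, ← coeff_coeffDeriv, ← map_sub, mode_apply]
  congr 2
  simp only [Derivation.leibniz, smul_eq_mul, hM n.succPNat]
  rw [dVar_inl_elemSeries, dVar_inr_elemSeries]
  ring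

/-- On modes `diffD` multiplies by -(-u)ⁿ/n, so its Schur polynomials act through any sequence `p`
that solves the Schur recursion for these multipliers. Both signs c = ±1 are used. The induction
varies M, since the recursion first replaces M by a multiple of (-u)^{n+1}M. -/
lemma elemSchur_smul_diffD_mode (c : ℂ) (p : ℕ → XY⟦X⟧) (h0 : p 0 = 1)
    (hp : ∀ b, ((b + 1 : ℕ) : ℂ) • p (b + 1) =
      -(c • ∑ n ∈ range (b + 1), p (b - n) * (-X) ^ (n + 1)))
    {M : XY⟦X⟧} (hM : IsDiffConst M) (l : ℤ) (k b : ℕ) :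
    elemSchur (fun n => c • diffD n) b (mode l k M) = mode l k (p b * M) := by
  induction b using Nat.strong_induction_on generalizing M with
  | _ b ih =>
    rcases b with _ | b
    · rw [elemSchur_zero, h0, one_mul]; rfl
    have h := DFunLike.congr_fun (elemSchur_succ (fun n => c • diffD n)
      (fun m n => by simp only [smul_mul_smul_comm, diffD_comm m n]) b) (mode l k M)
    have hb : ((b + 1 : ℕ) : ℂ) ≠ 0 := by exact_mod_cast b.succ_ne_zero
    rw [LinearMap.smul_apply] at h
    refine smul_right_injective Boson hb ?_
    simp only
    rw [h, ← map_smul, ← smul_mul_assoc, hp, LinearMap.sum_apply, neg_mul, smul_mul_assoc, sum_mul,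
      smul_sum, ← sum_neg_distrib, map_sum]
    refine sum_congr rfl fun n hn => ?_
    rw [LinearMap.smul_apply, Module.End.mul_apply, ← map_smul, LinearMap.smul_apply, smul_comm,
      diffD_mode hM, ← map_smul, ih (b - n) (by omega)]
    · congr 1
      rw [mul_smul_comm, mul_neg, smul_neg, mul_assoc]
    · have hX (m : ℕ) : IsDiffConst ((-X) ^ m) := fun n => by
        rw [Derivation.leibniz_pow, Derivation.leibniz_pow, map_neg, map_neg, isDiffConst_X]
      intro m
      rw [Derivation.map_smul, Derivation.map_smul, map_neg, map_neg, (hX (n + 1)).mul hM m]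

/-- `exp (∑ₙ (∂/∂xₙ - ∂/∂yₙ) z⁻ⁿ / n)` acts on modes as multiplication by `1 + u/z`. -/
lemma elemSchur_diffD_mode {M : XY⟦X⟧} (hM : IsDiffConst M) (l : ℤ) (k b : ℕ) :
    elemSchur diffD b (mode l k M) =
      mode l k ((if b = 0 then 1 else if b = 1 then X else 0) * M) := by
  have h := elemSchur_smul_diffD_mode 1 (fun b => if b = 0 then 1 else if b = 1 then X else 0)
    (if_pos rfl) (fun b => ?_) hM l k b
  · simpa only [one_smul] using h
  rcases b with _ | b
  · simp
  · rw [sum_range_succ, sum_range_succ, sum_eq_zero]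
    · simp [pow_succ]
      ring
    · intro n hn
      have := mem_range.1 hn
      rw [if_neg (by omega), if_neg (by omega), zero_mul]

/-- `exp (-∑ₙ (∂/∂xₙ - ∂/∂yₙ) z⁻ⁿ / n)` acts on modes as multiplication by `1 / (1 + u/z)`. -/
lemma elemSchur_neg_diffD_mode {M : XY⟦X⟧} (hM : IsDiffConst M) (l : ℤ) (k b : ℕ) :
    elemSchur (fun n => -diffD n) b (mode l k M) = mode l k ((-X) ^ b * M) := by
  have h := elemSchur_smul_diffD_mode (-1) (fun b => (-X) ^ b) (pow_zero _) (fun b => ?_) hM l k b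
  · have e : (fun n => (-1 : ℂ) • diffD n) = fun n => -diffD n :=
      funext fun n => LinearMap.ext fun F => neg_one_smul ℂ (diffD n F)
    rwa [e] at h
  rw [neg_smul, neg_neg, one_smul, Nat.cast_smul_eq_nsmul, ← card_range (b + 1), ← sum_const,
    card_range]
  refine sum_congr rfl fun n hn => ?_
  rw [← pow_add]
  congr 1
  have := mem_range.1 hn
  omega

/-! ### Creation operators on modes -/

lemma bosonSum_eq_sum {ι : Type} {u : ι → Boson} (s : Finset ι) (h : ∀ i ∉ s, u i = 0) :
    bosonSum u = ∑ i ∈ s, u i := by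
  funext l
  ext d
  rw [Finset.sum_apply, map_sum]
  refine finsum_eq_sum_of_support_subset _ fun i hi => ?_
  by_contra hs
  exact hi (by simp [h i hs])

/-- The second exponential is 1 + u/z, so only b = 0 and b = 1 contribute, with a = j and a = j + 1.
-/
lemma phi_mode {M : XY⟦X⟧} (hM : IsDiffConst M) (j : ℕ) (l : ℤ) (k : ℕ) :
    phi (-((j + 1 : ℕ) : ℤ)) (mode l k M) = mode (l - 1) k (schurPair j * M) := by
  rw [phi, bosonSum_eq_sum {(j, 0), (j + 1, 1)}, sum_pair (by simp), if_pos (by simp),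
    if_pos (by push_cast; ring), elemSchur_diffD_mode hM, elemSchur_diffD_mode hM, mulXY_mode,
    mulXY_mode, ← map_add, mulP_mode, ← sub_eq_add_neg]
  · congr 1
    simp only [schurPair, schurNeg, coeff_schurSeries, if_true, one_ne_zero, if_false]
    ring
  · rintro ⟨a, b⟩ hab
    simp only [mem_insert, mem_singleton, Prod.mk.injEq, not_or, not_and] at hab
    split_ifs with h
    · rw [elemSchur_diffD_mode hM, if_neg, if_neg, zero_mul, map_zero, map_zero]
      all_goals
        rintro rfl
        simp only [not_true_eq_false, imp_false] at hab h
        push_cast at h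
        omega
    · rfl

/-- `∑_b S_{n+1+b}(x+y) (-u)ᵇ`. -/
def schurTail (n : ℕ) : XY⟦X⟧ := mk fun b => (-1) ^ b * coeff (n + 1 + b) schurPos

lemma coeff_zero_schurPos : coeff 0 schurPos = 1 := by
  rw [schurPos, coeff_schurSeries, elemSchur_zero]

/-- This shift relation is what makes the sum in `isEuler_schurPair` telescope. -/
lemma schurTail_succ (n : ℕ) :
    X * schurTail (n + 1) = C (coeff (n + 1) schurPos) - schurTail n := by
  ext1 b
  rcases b with _ | b
  · simp [schurTail]
  · rw [coeff_succ_X_mul, map_sub, coeff_C, if_neg (by omega), schurTail, schurTail, coeff_mk,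
      coeff_mk, show n + 1 + 1 + b = n + 1 + (b + 1) by ring]
    ring

/-- The series `∑_b S_b(x+y) (-u)ᵇ`. -/
lemma mk_schurPos : mk (fun b => (-1) ^ b * coeff b schurPos) = 1 - X * schurTail 0 := by
  ext1 b
  rcases b with _ | b
  · simp [coeff_zero_schurPos]
  · rw [map_sub, coeff_succ_X_mul, coeff_one, if_neg (by omega), schurTail, coeff_mk,
      coeff_mk, show 0 + 1 + b = b + 1 by ring]
    ring

/-! ### Series on which `φ*₀` acts by `∂/∂u` -/

/-- The conditions on `M`, a series of degree `m` in the operators `φ₋ⱼ`, under which `φ*₀` acts on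
the modes of `M · elemSeries` as `∂/∂u`; `N` bounds the variables `xₙ` which occur in `M`. -/
structure IsEuler (N m : ℕ) (M : XY⟦X⟧) : Prop where
  diffConst : IsDiffConst M
  dVar_eq_zero : ∀ n, N ≤ n → dVar (Sum.inl n.succPNat) M = 0
  euler : ∑ n ∈ range N, schurTail (n + 1) * dVar (Sum.inl n.succPNat) M =
    (m : XY⟦X⟧) * schurTail 0 * M - schurTail 0 * X * derivative XY M + derivative XY M

lemma isEuler_one (N : ℕ) : IsEuler N 0 1 where
  diffConst := fun n => by rw [Derivation.map_one_eq_zero, Derivation.map_one_eq_zero]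
  dVar_eq_zero := fun n _ => Derivation.map_one_eq_zero _
  euler := by simp

/-- Apart from the term with m, both sides of the identity are derivations in M; the degrees m
therefore add. -/
lemma IsEuler.mul {N m m' : ℕ} {M M' : XY⟦X⟧} (hM : IsEuler N m M) (hM' : IsEuler N m' M') :
    IsEuler N (m + m') (M * M') where
  diffConst := hM.diffConst.mul hM'.diffConst
  dVar_eq_zero := fun n hn => by
    rw [Derivation.leibniz, hM.dVar_eq_zero n hn, hM'.dVar_eq_zero n hn, smul_zero, smul_zero,
      add_zero]
  euler := by
    have h : ∑ n ∈ range N, schurTail (n + 1) * dVar (Sum.inl n.succPNat) (M * M') =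
        M * ∑ n ∈ range N, schurTail (n + 1) * dVar (Sum.inl n.succPNat) M' +
          M' * ∑ n ∈ range N, schurTail (n + 1) * dVar (Sum.inl n.succPNat) M := by
      rw [mul_sum, mul_sum, ← sum_add_distrib]
      refine sum_congr rfl fun n _ => ?_
      rw [Derivation.leibniz, smul_eq_mul, smul_eq_mul]
      ring
    rw [h, hM.euler, hM'.euler, Derivation.leibniz, smul_eq_mul, smul_eq_mul]
    push_cast
    ring

lemma IsEuler.pow {N m : ℕ} {M : XY⟦X⟧} (hM : IsEuler N m M) (k : ℕ) :
    IsEuler N (m * k) (M ^ k) := by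
  induction k with
  | zero => rw [pow_zero]; exact isEuler_one N
  | succ k ih => rw [pow_succ, mul_add_one]; exact ih.mul hM

lemma IsEuler.add {N m : ℕ} {M M' : XY⟦X⟧} (hM : IsEuler N m M) (hM' : IsEuler N m M') :
    IsEuler N m (M + M') where
  diffConst := fun n => by rw [map_add, map_add, hM.diffConst, hM'.diffConst]
  dVar_eq_zero := fun n hn => by
    rw [map_add, hM.dVar_eq_zero n hn, hM'.dVar_eq_zero n hn, add_zero]
  euler := by
    simp only [map_add, mul_add, sum_add_distrib]
    rw [hM.euler, hM'.euler]
    ring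

lemma IsEuler.smul {N m : ℕ} {M : XY⟦X⟧} (c : ℂ) (hM : IsEuler N m M) : IsEuler N m (c • M) where
  diffConst := fun n => by rw [Derivation.map_smul, Derivation.map_smul, hM.diffConst]
  dVar_eq_zero := fun n hn => by
    rw [Derivation.map_smul, hM.dVar_eq_zero n hn, smul_zero]
  euler := by
    have h : derivative XY (c • M) = c • derivative XY M :=
      ((derivative XY).restrictScalars ℂ).map_smul c M
    simp only [Derivation.map_smul, h, mul_smul_comm]
    rw [← smul_sum, hM.euler, smul_add, smul_sub]

lemma isEuler_zero (N m : ℕ) : IsEuler N m 0 := by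
  have h : IsEuler N m ((0 : ℂ) • 0) :=
    ⟨fun n => by simp, fun n _ => by simp, by simp⟩
  simpa using h

lemma isEuler_sum {ι : Type} {N m : ℕ} (s : Finset ι) {M : ι → XY⟦X⟧}
    (hM : ∀ i ∈ s, IsEuler N m (M i)) : IsEuler N m (∑ i ∈ s, M i) := by
  classical
  induction s using Finset.induction_on with
  | empty => rw [sum_empty]; exact isEuler_zero N m
  | insert i s hi ih =>
    rw [sum_insert hi]
    exact (hM i (mem_insert_self _ _)).add (ih fun j hj => hM j (mem_insert_of_mem hj))

lemma pderiv_coeff_schurNeg (n j : ℕ) :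
    MvPowerSeries.pderiv ℂ (Sum.inl n.succPNat) (coeff j schurNeg) =
      -coeff j (X ^ (n + 1) * schurNeg) := by
  rw [← coeff_coeffDeriv, dVar_inl_schurNeg, map_neg]

lemma dVar_schurPair (n j : ℕ) : dVar (Sum.inl n.succPNat) (schurPair j) =
    -(C (coeff j (X ^ (n + 1) * schurNeg)) + C (coeff (j + 1) (X ^ (n + 1) * schurNeg)) * X) := by
  ext1 k
  rw [coeff_coeffDeriv, schurPair, map_add, map_add, coeff_C_mul, coeff_X, coeff_C, map_neg,
    map_add, coeff_C_mul, coeff_X, coeff_C]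
  split_ifs <;> simp [pderiv_coeff_schurNeg, add_comm]

/-- Since ∂/∂xₙ lowers the index of Sⱼ(-x-y) by n with a sign, the shift relation for `schurTail`
turns the sum into a telescoping part and a convolution, the latter evaluated by ∑ Sᵢ(x+y)uⁱ · ∑
Sᵢ(-x-y)uⁱ = 1. -/
lemma isEuler_schurPair {N j : ℕ} (hj : j < N) : IsEuler N 1 (schurPair j) where
  diffConst := isDiffConst_schurPair j
  dVar_eq_zero := fun n hn => by
    rw [dVar_schurPair, coeff_X_pow_mul', coeff_X_pow_mul', if_neg (by omega), if_neg (by omega)]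
    simp
  euler := by
    have hterm (n : ℕ) : schurTail (n + 1) * dVar (Sum.inl n.succPNat) (schurPair j) =
        -((schurTail (n + 1) * C (coeff (j + 1) (X ^ (n + 1 + 1) * schurNeg)) -
            schurTail n * C (coeff (j + 1) (X ^ (n + 1) * schurNeg))) +
          C (coeff (n + 1) schurPos * coeff (j + 1) (X ^ (n + 1) * schurNeg))) := by
      rw [dVar_schurPair, pow_succ' X (n + 1), mul_assoc X, coeff_succ_X_mul, RingHom.map_mul]
      linear_combination (-C (coeff (j + 1) (X ^ (n + 1) * schurNeg))) * schurTail_succ n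
    have hconv : ∑ n ∈ range N, coeff (n + 1) schurPos * coeff (j + 1) (X ^ (n + 1) * schurNeg) =
        -coeff (j + 1) schurNeg := by
      have h := congrArg (coeff (j + 1)) schurNeg_mul_schurPos
      rw [mul_comm, coeff_mul, Nat.sum_antidiagonal_eq_sum_range_succ_mk, sum_range_succ',
        coeff_zero_schurPos, coeff_one, if_neg (by omega)] at h
      rw [← sum_subset (range_mono (Nat.succ_le_of_lt hj)), eq_neg_iff_add_eq_zero, ← h]
      · simp only [Nat.sub_zero, one_mul]
        congr 1
        refine sum_congr rfl fun n hn => ?_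
        have := mem_range.1 hn
        rw [coeff_X_pow_mul', if_pos (by omega)]
      · intro n _ hn
        rw [coeff_X_pow_mul', if_neg (by simp at hn; omega), mul_zero]
    simp only [hterm]
    -- The upper boundary term vanishes because j < N; the lower one is T₀ Sⱼ(-x-y), where T₀ =
    -- `schurTail 0`.
    rw [sum_neg_distrib, sum_add_distrib, sum_range_sub (fun n =>
      schurTail n * C (coeff (j + 1) (X ^ (n + 1) * schurNeg))), ← map_sum, hconv,
      coeff_X_pow_mul', if_neg (by omega), zero_add, pow_one, coeff_succ_X_mul]
    have hd : derivative XY (schurPair j) = C (coeff (j + 1) schurNeg) := by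
      rw [schurPair, map_add, derivative_C, Derivation.leibniz, derivative_C, derivative_X]
      simp
    rw [hd, schurPair]
    simp only [map_neg, map_zero, Nat.cast_one]
    ring

/-! ### The action of `φ*₀` -/

lemma mode_mul_congr {l : ℤ} {k : ℕ} {F F' : XY⟦X⟧} (h : ∀ b ≤ k, coeff b F = coeff b F')
    (M : XY⟦X⟧) : mode l k (F * M) = mode l k (F' * M) := by
  rw [mode_apply, mode_apply, mul_assoc, mul_assoc, coeff_mul, coeff_mul]
  congr 1
  exact sum_congr rfl fun p hp => by rw [h p.1 (by have := mem_antidiagonal.1 hp; omega)]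

lemma mode_X_pow_mul {l : ℤ} {k b : ℕ} (h : k < b) (M : XY⟦X⟧) : mode l k ((-X) ^ b * M) = 0 := by
  rw [mode_mul_congr (F' := 0), zero_mul, map_zero]
  intro c hc
  rw [neg_pow, ← map_one C, ← map_neg, ← map_pow, coeff_C_mul, coeff_X_pow, if_neg (by omega),
    mul_zero, map_zero]

lemma coeff_sum_C_mul_neg_X_pow (c : ℕ → XY) {k b : ℕ} (h : b ≤ k) :
    coeff b (∑ n ∈ range (k + 1), C (c n) * (-X) ^ n) = (-1) ^ b * c b := by
  rw [map_sum, sum_eq_single b]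
  · rw [neg_pow, ← map_one C, ← map_neg, ← map_pow, coeff_C_mul, coeff_C_mul, coeff_X_pow,
      if_pos rfl]
    ring
  · intro n _ hn
    rw [neg_pow, ← map_one C, ← map_neg, ← map_pow, coeff_C_mul, coeff_C_mul, coeff_X_pow,
      if_neg hn.symm, mul_zero, mul_zero]
  · intro hb
    exact absurd (mem_range.2 (by omega)) hb

lemma alpha_negSucc_mode (r : ℕ) (l : ℤ) (k : ℕ) (M : XY⟦X⟧) :
    alpha (Int.negSucc r) (mode l k M) = mode l k (C ((r + 1 : XY) * x r.succPNat) * M) := by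
  rw [← mulXY_mode, alpha, Nat.cast_smul_eq_nsmul, nsmul_eq_mul]
  push_cast
  rfl

lemma alpha_zero_mode (l : ℤ) (k : ℕ) (M : XY⟦X⟧) :
    alpha (Int.ofNat 0) (mode l k M) = mode l k ((l : XY⟦X⟧) * M) := by
  rw [alpha, mode_apply, pDp_single, mode_apply, Int.cast_smul_eq_zsmul, ← map_zsmul, mul_assoc,
    zsmul_eq_mul]

lemma alpha_succ_mode (n : ℕ) (l : ℤ) (k : ℕ) (M : XY⟦X⟧) :
    alpha (Int.ofNat (n + 1)) (mode l k M) =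
      mode l k (dVar (Sum.inl n.succPNat) M - (-X) ^ (n + 1) * M) := by
  rw [alpha, mode_apply, partialD_single, ← coeff_coeffDeriv, Derivation.leibniz,
    dVar_inl_elemSeries, mode_apply, smul_eq_mul, smul_eq_mul]
  congr 2
  ring

lemma dVar_neg_X_pow_mul (v : Var) (b : ℕ) (M : XY⟦X⟧) :
    dVar v ((-X) ^ b * M) = (-X) ^ b * dVar v M := by
  have hX : dVar v X = 0 := by
    ext1 k
    rw [coeff_coeffDeriv, coeff_X]
    split_ifs <;> simp
  rw [Derivation.leibniz, Derivation.leibniz_pow, map_neg, hX]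
  simp

lemma sum_ite_mulXY_of_nonneg {A n b : ℕ} (h : n + 1 + b < A) (V : Boson) :
    ∑ a ∈ range A, (if (a : ℤ) + (-Int.ofNat n - 1) - b = -0 then
      mulXY (elemSchur (fun n => x n + y n) a) V else 0) =
        mulXY (coeff (n + 1 + b) schurPos) V := by
  rw [sum_eq_single (n + 1 + b)]
  · rw [if_pos (by simp only [Int.ofNat_eq_natCast]; push_cast; ring), schurPos, coeff_schurSeries]
  · intro a _ ha
    rw [if_neg]
    simp only [Int.ofNat_eq_natCast]
    omega
  · intro ha
    exact absurd (mem_range.2 h) ha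

lemma sum_ite_mulXY_of_neg {A r b : ℕ} (h : b < A) (V : Boson) :
    ∑ a ∈ range A, (if (a : ℤ) + (-Int.negSucc r - 1) - b = -0 then
      mulXY (elemSchur (fun n => x n + y n) a) V else 0) =
        mulXY (coeff b (X ^ r * schurPos)) V := by
  rw [coeff_X_pow_mul']
  split_ifs with hr
  · rw [sum_eq_single (b - r)]
    · rw [if_pos (by rw [Int.negSucc_eq]; omega), schurPos, coeff_schurSeries]
    · intro a _ ha
      rw [if_neg]
      rw [Int.negSucc_eq]
      omega
    · intro ha
      exact absurd (mem_range.2 (by omega)) ha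
  · have h0 : mulXY 0 V = 0 := by funext l; exact zero_mul _
    rw [h0]
    refine sum_eq_zero fun a _ => if_neg ?_
    rw [Int.negSucc_eq]
    omega

/-- The three summands come from the modes αₙ with n < 0, n = 0 and n > 0. For given n and b the
exponent of z fixes a, and powers of u beyond k are invisible to [u^k], which makes every sum
finite. -/
lemma phiStar_mode_eq_sum {N : ℕ} {M : XY⟦X⟧} (hM : IsDiffConst M)
    (hN : ∀ n, N ≤ n → dVar (Sum.inl n.succPNat) M = 0) (l : ℤ) {k : ℕ} (hk : k ≤ N) :
    phiStar 0 (mode l k M) = mode (l + 1) k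
      ((∑ b ∈ range (k + 1), C (∑ r ∈ range (k + 1),
          (r + 1 : XY) * x r.succPNat * coeff b (X ^ r * schurPos)) * (-X) ^ b) * M +
        (∑ b ∈ range (k + 1), C (coeff (b + 1) schurPos) * (-X) ^ b) * ((l : XY⟦X⟧) * M) +
        ∑ n ∈ range N, (∑ b ∈ range (k + 1), C (coeff (n + 1 + 1 + b) schurPos) * (-X) ^ b) *
          (dVar (Sum.inl n.succPNat) M - (-X) ^ (n + 1) * M)) := by
  have hdisj : Disjoint ((range (k + 1)).image Int.negSucc) ((range (N + 1)).image Int.ofNat) := by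
    rw [disjoint_left]
    intro n hn hn'
    obtain ⟨r, _, rfl⟩ := mem_image.1 hn
    obtain ⟨r', _, h⟩ := mem_image.1 hn'
    exact Int.noConfusion h
  rw [phiStar, bosonSum_eq_sum (range (N + k + 3) ×ˢ (((range (k + 1)).image Int.negSucc ∪
    (range (N + 1)).image Int.ofNat) ×ˢ range (k + 1))), ← mulP_mode]
  · congr 1
    simp only [elemSchur_neg_diffD_mode hM]
    rw [sum_product_right, sum_product, sum_union hdisj,
      sum_image fun _ _ _ _ h => Int.negSucc_inj.1 h, sum_image (g := Int.ofNat) fun _ _ _ _ h => Int.ofNat.inj h,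
      sum_range_succ' _ N]
    have h1 : ∀ r ∈ range (k + 1), ∀ b ∈ range (k + 1),
        ∑ a ∈ range (N + k + 3), (if (a : ℤ) + (-Int.negSucc r - 1) - b = -0 then
          mulXY (elemSchur (fun n => x n + y n) a)
            (alpha (Int.negSucc r) (mode l k ((-X) ^ b * M))) else 0) =
          mode l k (C ((r + 1 : XY) * x r.succPNat * coeff b (X ^ r * schurPos)) * (-X) ^ b * M) := by
      intro r hr b hb
      have := mem_range.1 hb
      rw [sum_ite_mulXY_of_neg (by omega), alpha_negSucc_mode, mulXY_mode]
      simp only [RingHom.map_mul]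
      congr 1
      ring
    have h2 : ∀ b ∈ range (k + 1),
        ∑ a ∈ range (N + k + 3), (if (a : ℤ) + (-Int.ofNat 0 - 1) - b = -0 then
          mulXY (elemSchur (fun n => x n + y n) a)
            (alpha (Int.ofNat 0) (mode l k ((-X) ^ b * M))) else 0) =
          mode l k (C (coeff (b + 1) schurPos) * (-X) ^ b * ((l : XY⟦X⟧) * M)) := by
      intro b hb
      have := mem_range.1 hb
      rw [sum_ite_mulXY_of_nonneg (by omega), alpha_zero_mode, mulXY_mode,
        show 0 + 1 + b = b + 1 by ring]
      congr 1
      ring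
    have h3 : ∀ n ∈ range N, ∀ b ∈ range (k + 1),
        ∑ a ∈ range (N + k + 3), (if (a : ℤ) + (-Int.ofNat (n + 1) - 1) - b = -0 then
          mulXY (elemSchur (fun n => x n + y n) a)
            (alpha (Int.ofNat (n + 1)) (mode l k ((-X) ^ b * M))) else 0) =
          mode l k (C (coeff (n + 1 + 1 + b) schurPos) * (-X) ^ b *
            (dVar (Sum.inl n.succPNat) M - (-X) ^ (n + 1) * M)) := by
      intro n hn b hb
      have := mem_range.1 hb
      have := mem_range.1 hn
      rw [sum_ite_mulXY_of_nonneg (by omega), alpha_succ_mode, mulXY_mode, dVar_neg_X_pow_mul]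
      congr 1
      ring
    rw [sum_congr rfl fun r hr => sum_congr rfl (h1 r hr), sum_congr rfl h2,
      sum_congr rfl fun n hn => sum_congr rfl (h3 n hn), sum_comm (s := range (k + 1))]
    simp only [← map_sum, ← map_add, ← sum_mul]
    congr 1
    ring
  -- Outside the box a term vanishes: b > k gives too high a power of u. An αₙ with n > N
  -- differentiates only E, since M is free of xₙ, and again produces a power above k because k ≤ N.
  -- The other cases contradict the exponent condition.
  · rintro ⟨a, n, b⟩ hq
    split_ifs with h
    · rw [elemSchur_neg_diffD_mode hM]
      rcases lt_or_ge k b with hb | hb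
      · rw [mode_X_pow_mul hb, map_zero, map_zero]
      rcases n with (_ | n) | r
      · refine absurd ?_ hq
        simp only [mem_product, mem_range, mem_union, mem_image]
        refine ⟨?_, Or.inr ⟨0, by omega, rfl⟩, by omega⟩
        simp only [Int.ofNat_eq_natCast] at h
        omega
      · rcases lt_or_ge n N with hn | hn
        · refine absurd ?_ hq
          simp only [mem_product, mem_range, mem_union, mem_image]
          refine ⟨?_, Or.inr ⟨n + 1, by omega, rfl⟩, by omega⟩
          simp only [Int.ofNat_eq_natCast] at h
          omega
        · rw [alpha_succ_mode, dVar_neg_X_pow_mul, hN n hn, mul_zero, zero_sub, map_neg,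
            mode_X_pow_mul (by omega), neg_zero, map_zero]
      · refine absurd ?_ hq
        simp only [Int.negSucc_eq] at h
        simp only [mem_product, mem_range, mem_union, mem_image]
        exact ⟨by omega, Or.inl ⟨r, by omega, rfl⟩, by omega⟩
    · rfl

/-- Splitting (-1)^b = (-1)^r(-1)^{b-r} exhibits the sum as a Cauchy product. -/
lemma coeff_sum_negative_modes {k b : ℕ} (hb : b ≤ k) :
    (-1) ^ b * ∑ r ∈ range (k + 1), (r + 1 : XY) * x r.succPNat * coeff b (X ^ r * schurPos) =
      coeff b (logDeriv * (1 - X * schurTail 0)) := by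
  rw [← mk_schurPos, coeff_mul, Nat.sum_antidiagonal_eq_sum_range_succ_mk,
    ← sum_subset (range_mono (Nat.succ_le_succ hb)), mul_sum]
  · refine sum_congr rfl fun r hr => ?_
    have hr' : r ≤ b := by have := mem_range.1 hr; omega
    rw [coeff_X_pow_mul', if_pos hr', logDeriv, coeff_mk, coeff_mk]
    nth_rewrite 1 [← Nat.add_sub_cancel' hr']
    rw [pow_add]
    ring
  · intro r _ hr
    rw [coeff_X_pow_mul', if_neg (by simp at hr; omega), mul_zero]

/-- Each n < b contributes the same term (-1)^b S_{b+1}(x+y), so the coefficient acquires the factor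
b, which is the effect of u d/du. All these n are present because b ≤ N. -/
lemma coeff_sum_schurTail {N b : ℕ} (hb : b ≤ N) :
    coeff b (∑ n ∈ range N, schurTail (n + 1) * (-X) ^ (n + 1)) =
      coeff b (X * derivative XY (schurTail 0)) := by
  have hterm (n : ℕ) : coeff b (schurTail (n + 1) * (-X) ^ (n + 1)) =
      if n < b then (-1) ^ b * coeff (b + 1) schurPos else 0 := by
    rw [neg_pow, ← map_one C, ← map_neg, ← map_pow, mul_comm, mul_assoc, coeff_C_mul,
      coeff_X_pow_mul']
    simp only [Nat.succ_le_iff]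
    split_ifs with h
    · rw [schurTail, coeff_mk, ← mul_assoc, ← pow_add, show n + 1 + (b - (n + 1)) = b by omega,
        show n + 1 + 1 + (b - (n + 1)) = b + 1 by omega]
    · rw [mul_zero]
  rw [map_sum, sum_congr rfl fun n _ => hterm n, ← sum_filter, sum_const, nsmul_eq_mul,
    show #{n ∈ range N | n < b} = b by
      rw [← card_range b]; congr 1; ext n; simp; omega]
  rcases b with _ | b
  · simp
  · rw [coeff_succ_X_mul, coeff_derivative, schurTail, coeff_mk, show 0 + 1 + (b + 1) = b + 1 + 1 by ring]
    push_cast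
    ring

/-- The operator u d/du multiplies the coefficient of u^k by k. This trades the p-degree in the
α₀-term for a derivative in u. -/
lemma mode_natCast_mul (l : ℤ) (k : ℕ) (F : XY⟦X⟧) :
    mode l k ((k : XY⟦X⟧) * F) = mode l k (X * derivative XY F + X * logDeriv * F) := by
  rw [mode_apply, mode_apply]
  congr 1
  have h : (X * derivative XY F + X * logDeriv * F) * elemSeries =
      X * derivative XY (F * elemSeries) := by
    rw [Derivation.leibniz, derivative_elemSeries, smul_eq_mul, smul_eq_mul]
    ring
  rw [h, mul_assoc, ← nsmul_eq_mul, map_nsmul, nsmul_eq_mul]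
  rcases k with _ | k
  · simp
  · rw [coeff_succ_X_mul, coeff_derivative]
    push_cast
    ring

/-- `φ*₀` acts on modes as `∂/∂u`. -/
lemma phiStar_mode {N m : ℕ} {M : XY⟦X⟧} (hM : IsEuler N m M) {k : ℕ} (hk : k ≤ N) :
    phiStar 0 (mode ((k : ℤ) - m) k M) =
      ((k + 1 : ℕ) : ℂ) • mode ((k : ℤ) - m + 1) (k + 1) M := by
  have htail (n : ℕ) (F : XY⟦X⟧) : mode ((k : ℤ) - m + 1) k
      ((∑ b ∈ range (k + 1), C (coeff (n + 1 + b) schurPos) * (-X) ^ b) * F) =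
        mode ((k : ℤ) - m + 1) k (schurTail n * F) :=
    mode_mul_congr (fun b hb => by rw [coeff_sum_C_mul_neg_X_pow _ hb, schurTail, coeff_mk]) F
  have hneg : mode ((k : ℤ) - m + 1) k ((∑ b ∈ range (k + 1), C (∑ r ∈ range (k + 1),
      (r + 1 : XY) * x r.succPNat * coeff b (X ^ r * schurPos)) * (-X) ^ b) * M) =
        mode ((k : ℤ) - m + 1) k (logDeriv * (1 - X * schurTail 0) * M) :=
    mode_mul_congr (fun b hb => by
      rw [coeff_sum_C_mul_neg_X_pow _ hb, coeff_sum_negative_modes hb]) M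
  have hzero := htail 0 ((((k : ℤ) - m : ℤ) : XY⟦X⟧) * M)
  simp only [zero_add, add_comm 1] at hzero
  rw [phiStar_mode_eq_sum hM.diffConst hM.dVar_eq_zero _ hk, map_add, map_add, map_sum, hneg, hzero,
    sum_congr rfl fun n _ => htail (n + 1) _, ← map_sum]
  simp only [mul_sub, sum_sub_distrib, ← mul_assoc]
  rw [hM.euler, ← sum_mul, map_sub, mode_mul_congr (fun b hb => coeff_sum_schurTail (hb.trans hk)) M]
  -- The m in the α₀-eigenvalue k - m cancels against the term m T₀M of the Euler identity. The
  -- remaining k T₀M is rewritten by u d/du and cancels every other term with T₀ or its derivative;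
  -- M' + `logDeriv`·M is left, and its product with E is (ME)'.
  have hk0 := mode_natCast_mul ((k : ℤ) - m + 1) k (schurTail 0 * M)
  have hfin : mode ((k : ℤ) - m + 1) k (logDeriv * M + derivative XY M) =
      ((k + 1 : ℕ) : ℂ) • mode ((k : ℤ) - m + 1) (k + 1) M := by
    have h : (logDeriv * M + derivative XY M) * elemSeries = derivative XY (M * elemSeries) := by
      rw [Derivation.leibniz, derivative_elemSeries, smul_eq_mul, smul_eq_mul]
      ring
    rw [mode_apply, mode_apply, h, coeff_derivative, ← Pi.single_smul, Nat.cast_smul_eq_nsmul,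
      nsmul_eq_mul]
    push_cast
    rw [mul_comm]
  rw [← hfin, ← sub_eq_zero]
  rw [← sub_eq_zero] at hk0
  simp only [← map_add, ← map_sub] at hk0 ⊢
  rw [← hk0, Derivation.leibniz, smul_eq_mul, smul_eq_mul]
  congr 1
  push_cast
  ring

/-! ### The operator in the exponent -/

/-- `∑ⱼ aⱼ (S_{j-1}(-x-y) + Sⱼ(-x-y) u)`, the series by which `∑ⱼ aⱼ φ₋ⱼ` acts on modes. -/
def pairSum (s : ℕ) (a : ℕ → ℂ) : XY⟦X⟧ := ∑ j ∈ range s, a (j + 1) • schurPair j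

lemma sum_Icc_one_eq_sum_range {A : Type} [AddCommMonoid A] (s : ℕ) (f : ℕ → A) :
    ∑ j ∈ Icc 1 s, f j = ∑ j ∈ range s, f (j + 1) := by
  rw [← Ico_add_one_right_eq_Icc, sum_Ico_eq_sum_range, Nat.add_sub_cancel]
  simp only [add_comm 1]

lemma pairSum_eq (s : ℕ) (a : ℕ → ℂ) :
    pairSum s a = C (schurP s a) + C (schurQ s a) * X := by
  have hC (c : ℂ) (f : XY) : C (c • f) = c • C f := by
    ext1 k
    rw [coeff_smul, coeff_C, coeff_C]
    split_ifs <;> simp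
  rw [schurP, schurQ, sum_Icc_one_eq_sum_range, sum_Icc_one_eq_sum_range, pairSum, map_sum, map_sum,
    sum_mul, ← sum_add_distrib]
  refine sum_congr rfl fun j _ => ?_
  rw [hC, hC, smul_mul_assoc, ← smul_add]
  simp only [schurPair, schurNeg, coeff_schurSeries, Nat.add_sub_cancel]

lemma isEuler_pairSum_pow {N s : ℕ} (hN : s ≤ N) (a : ℕ → ℂ) (k : ℕ) :
    IsEuler N k (pairSum s a ^ k) := by
  have h : IsEuler N 1 (pairSum s a) := isEuler_sum _ fun j hj =>
    (isEuler_schurPair ((mem_range.1 hj).trans_le hN)).smul _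
  simpa using h.pow k

lemma vac_eq_mode : vac = mode 0 0 1 := by
  rw [vac, ofXY, mode_apply, one_mul, elemSeries, coeff_schurSeries, elemSchur_zero]

/-- The bound s + k on the variables covers both those in the factors with j ≤ s and the condition k
≤ N of `phiStar_mode`. -/
lemma expOp_mode (s : ℕ) (a : ℕ → ℂ) {k : ℕ} {M : XY⟦X⟧} (hM : IsEuler (s + k) k M) :
    expOp s a (mode 0 k M) = ((k + 1 : ℕ) : ℂ) • mode 0 (k + 1) (pairSum s a * M) := by
  have h := phiStar_mode hM (Nat.le_add_left k s)
  rw [sub_self, zero_add, ← map_smul] at h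
  rw [expOp, h, sum_Icc_one_eq_sum_range]
  simp only [phi_mode (hM.smul _).diffConst]
  rw [← map_smul, ← mul_smul_comm, pairSum, sum_mul, map_sum]
  refine sum_congr rfl fun j _ => ?_
  rw [smul_mul_assoc, map_smul, sub_self]

lemma expOp_iterate_vac (s : ℕ) (a : ℕ → ℂ) (k : ℕ) :
    (expOp s a)^[k] vac = (k ! : ℂ) • mode 0 k (pairSum s a ^ k) := by
  induction k with
  | zero => simp [vac_eq_mode]
  | succ k ih =>
    rw [Function.iterate_succ_apply', ih, ← map_smul,
      expOp_mode s a ((isEuler_pairSum_pow (Nat.le_add_right s k) a k).smul _), mul_smul_comm,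
      map_smul, smul_smul, ← pow_succ', Nat.factorial_succ, Nat.cast_mul]

/-! ### Weights -/

lemma isGraded_elemSeries : IsGraded elemSeries :=
  isGraded_schurSeries fun n => Ideal.mul_mem_left _ _ (neg_mem (x_mem_weightIdeal n))

lemma isGraded_schurNeg : IsGraded schurNeg :=
  isGraded_schurSeries fun n => sub_mem (neg_mem (x_mem_weightIdeal n)) (y_mem_weightIdeal n)

lemma isGraded_schurPair (j : ℕ) : IsGraded (schurPair j) := fun k => by
  rw [schurPair, map_add, coeff_C_mul, coeff_C, coeff_X]
  rcases k with _ | _ | k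
  · exact mem_weightIdeal_zero _
  · simpa using weightIdeal_anti (by omega) (isGraded_schurNeg (j + 1))
  · simp

lemma IsGraded.sum_smul {s : Finset ℕ} {F : ℕ → XY⟦X⟧} (c : ℕ → ℂ) (hF : ∀ i, IsGraded (F i)) :
    IsGraded (∑ i ∈ s, c i • F i) := fun k => by
  rw [map_sum]
  exact sum_mem fun i _ => by
    rw [coeff_smul]
    exact smul_mem_weightIdeal _ (hF i k)

lemma isGraded_pairSum (s : ℕ) (a : ℕ → ℂ) : IsGraded (pairSum s a) :=
  IsGraded.sum_smul _ isGraded_schurPair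

lemma schurQ_mem_weightIdeal (s : ℕ) (a : ℕ → ℂ) : schurQ s a ∈ weightIdeal 1 := by
  have h := isGraded_pairSum s a 1
  rw [pairSum_eq, map_add, coeff_C_mul, coeff_one_X, coeff_C, if_neg one_ne_zero] at h
  simpa using h

/-- This gives the local finiteness of all families of modes below. -/
lemma coeff_mode_eq_zero {M : XY⟦X⟧} (hM : IsGraded M) {k : ℕ} {d : Var →₀ ℕ} (hd : weight d < k)
    (l m : ℤ) : MvPowerSeries.coeff d (mode m k M l) = 0 := by
  rw [mode_apply]
  by_cases h : l = m
  · subst h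
    rw [Pi.single_eq_same]
    exact (hM.mul isGraded_elemSeries) k d hd
  · rw [Pi.single_eq_of_ne h, map_zero]

/-! ### The closed formula -/

/-- `∑ₘ (i+m choose i) qᵐ = (1 - q)^{-(i+1)}`. -/
lemma formalSum_choose_mul_pow {q : XY} (hq : q ∈ weightIdeal 1) (i : ℕ) :
    formalSum (fun m : ℕ => ((i + m).choose i : ℂ) • q ^ m) = (1 - q)⁻¹ ^ (i + 1) := by
  have hs : HasSubst q := HasSubst.of_constantCoeff_zero (constantCoeff_eq_zero hq)
  have h : formalSum (fun m : ℕ => ((i + m).choose i : ℂ) • q ^ m) =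
      subst q (mk fun m => ((i + m).choose i : ℂ)) := by
    ext d
    rw [coeff_subst hs]
    simp only [coeff_mk]
    rfl
  -- The binomial series is the inverse of (1 - X)^{i+1} in one variable; q may be substituted since
  -- it has no constant term.
  have hmul : (mk fun m => ((i + m).choose i : ℂ)) * (1 - X) ^ (i + 1) = 1 := by
    have := (invOneSubPow ℂ (i + 1)).val_inv
    rwa [invOneSubPow_val_succ_eq_mk_add_choose, invOneSubPow_inv_eq_one_sub_pow] at this
  have hsub := congrArg (substAlgHom hs) hmul
  rw [map_mul, map_pow, map_sub, map_one, coe_substAlgHom, subst_X hs] at hsub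
  have hinv : (1 - q) * (1 - q)⁻¹ = 1 := MvPowerSeries.mul_inv_cancel _ (by
    rw [map_sub, constantCoeff_eq_zero hq]; simp)
  rw [h]
  calc _ = subst q (mk fun m => ((i + m).choose i : ℂ)) * ((1 - q) * (1 - q)⁻¹) ^ (i + 1) := by
        rw [hinv, one_pow, mul_one]
    _ = _ := by rw [mul_pow, ← mul_assoc, hsub, one_mul]

lemma coeff_pairSum_pow_mul (s : ℕ) (a : ℕ → ℂ) (k : ℕ) :
    coeff k (pairSum s a ^ k * elemSeries) = ∑ p ∈ antidiagonal k,
      ((p.1 + p.2).choose p.1 : ℂ) • (schurP s a ^ p.1 * coeff p.1 elemSeries * schurQ s a ^ p.2) := by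
  rw [pairSum_eq, (Commute.all _ _).add_pow', sum_mul, map_sum]
  refine sum_congr rfl fun p hp => ?_
  rw [← mem_antidiagonal.1 hp, mul_pow, ← map_pow, ← map_pow, smul_mul_assoc, map_nsmul,
    Nat.cast_smul_eq_nsmul, mul_assoc, mul_assoc, coeff_C_mul, coeff_C_mul, coeff_X_pow_mul',
    if_pos (by omega), Nat.add_sub_cancel]
  congr 1
  ring

/-- Expanding (P + Qu)^k and summing over the power of Q first gives (1-Q)^{-(i+1)} for each i; one
factor is the prefactor, and the others rescale u to P/(1-Q) in E. -/
lemma tauFormula_eq_formalSum (s : ℕ) (a : ℕ → ℂ) :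
    tauFormula s a = formalSum fun k => coeff k (pairSum s a ^ k * elemSeries) := by
  have hQ := schurQ_mem_weightIdeal s a
  set P := schurP s a with hP
  set Q := schurQ s a with hQdef
  have hexp : formalExp (-formalSum fun n : ℕ+ => x n * (-P * (1 - Q)⁻¹) ^ (n : ℕ)) =
      formalSum fun k => (P * (1 - Q)⁻¹) ^ k * coeff k elemSeries := by
    rw [← formalSum_neg, formalExp_formalSum
      fun n => neg_mem (Ideal.mul_mem_right _ _ (x_mem_weightIdeal n))]
    congr 1
    funext k
    rw [elemSeries, coeff_schurSeries, ← elemSchur_rescale]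
    congr 1
    funext n
    rw [neg_mul, neg_pow]
    ring
  rw [tauFormula, ← hP, ← hQdef, hexp]
  refine eq_of_weightMk_eq fun n => ?_
  rw [map_mul, weightMk_formalSum_nat fun k => Ideal.mul_mem_left _ _ (isGraded_elemSeries k),
    weightMk_formalSum_nat fun k => ((isGraded_pairSum s a).pow k).mul isGraded_elemSeries k]
  simp only [coeff_pairSum_pow_mul, ← hP, ← hQdef, map_sum]
  rw [weightMk_sum_antidiagonal (fun p => ((p.1 + p.2).choose p.1 : ℂ) •
    (P ^ p.1 * coeff p.1 elemSeries * Q ^ p.2)) (fun p => smul_mem_weightIdeal _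
      (mul_mem_weightIdeal (Ideal.mul_mem_left _ _ (isGraded_elemSeries _))
        (by simpa using pow_mem_weightIdeal hQ p.2))), mul_sum]
  refine sum_congr rfl fun i _ => ?_
  have h := congrArg (weightMk n) (formalSum_choose_mul_pow hQ i)
  rw [weightMk_formalSum_nat fun m => smul_mem_weightIdeal _
    (by simpa using pow_mem_weightIdeal hQ m)] at h
  calc _ = weightMk n (P ^ i * coeff i elemSeries) * weightMk n ((1 - Q)⁻¹ ^ (i + 1)) := by
        rw [← map_mul, ← map_mul]
        congr 1
        ring
    _ = _ := by
        rw [← h, mul_sum]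
        refine sum_congr rfl fun m _ => ?_
        rw [← map_mul, mul_smul_comm]

lemma coeff_ofXY_tauFormula (s : ℕ) (a : ℕ → ℂ) (l : ℤ) (d : Var →₀ ℕ) :
    MvPowerSeries.coeff d (ofXY (tauFormula s a) l) =
      ∑ k ∈ range (weight d + 1), MvPowerSeries.coeff d (mode 0 k (pairSum s a ^ k) l) := by
  simp only [ofXY, mode_apply]
  by_cases hl : l = 0
  · subst hl
    simp only [Pi.single_eq_same]
    have h := weightMk_formalSum_nat
      (fun k => ((isGraded_pairSum s a).pow k).mul isGraded_elemSeries k) (weight d + 1)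
    rw [← tauFormula_eq_formalSum, ← map_sum, weightMk_eq_iff] at h
    rw [h d (Nat.lt_succ_self _), map_sum]
  · simp only [Pi.single_eq_of_ne hl, map_zero, sum_const_zero]

lemma hasBosonSum_expOp (s : ℕ) (a : ℕ → ℂ) :
    HasBosonSum (fun k : ℕ => ((k ! : ℂ)⁻¹) • (expOp s a)^[k] vac) (ofXY (tauFormula s a)) := by
  have hu (k : ℕ) : ((k ! : ℂ)⁻¹) • (expOp s a)^[k] vac = mode 0 k (pairSum s a ^ k) := by
    rw [expOp_iterate_vac, smul_smul, inv_mul_cancel₀ (by exact_mod_cast k.factorial_ne_zero),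
      one_smul]
  have hsub (l : ℤ) (d : Var →₀ ℕ) :
      {k | MvPowerSeries.coeff d (mode 0 k (pairSum s a ^ k) l) ≠ 0} ⊆ range (weight d + 1) := by
    intro k hk
    by_contra h
    exact hk (coeff_mode_eq_zero ((isGraded_pairSum s a).pow k) (by simpa using h) _ _)
  simp only [hu]
  refine ⟨fun l d => (finite_toSet _).subset (hsub l d), ?_⟩
  funext l
  ext d
  rw [coeff_ofXY_tauFormula]
  exact finsum_eq_sum_of_support_subset _ (hsub l d)

/-! ### Images of basis vectors -/

lemma phiStar_iterate_vac (k : ℕ) : (phiStar 0)^[k] vac = (k ! : ℂ) • mode k k 1 := by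
  induction k with
  | zero => simp [vac_eq_mode]
  | succ k ih =>
    have h := phiStar_mode ((isEuler_one k).smul (k ! : ℂ)) le_rfl
    rw [Nat.cast_zero, sub_zero] at h
    rw [Function.iterate_succ_apply', ih, ← map_smul, h, map_smul, smul_smul, Nat.factorial_succ,
      Nat.cast_mul, Nat.cast_add_one (R := ℤ)]

lemma IsDiffConst.pow {M : XY⟦X⟧} (hM : IsDiffConst M) (n : ℕ) : IsDiffConst (M ^ n) := fun i => by
  rw [Derivation.leibniz_pow, Derivation.leibniz_pow, hM i]

lemma phi_iterate_mode {M : XY⟦X⟧} (hM : IsDiffConst M) (i : ℕ+) (n : ℕ) (l : ℤ) (k : ℕ) :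
    (phi (-((i : ℕ) : ℤ)))^[n] (mode l k M) = mode (l - n) k (schurPair i.natPred ^ n * M) := by
  induction n with
  | zero => simp
  | succ n ih =>
    rw [Function.iterate_succ_apply', ih, ← i.natPred_add_one,
      phi_mode (((isDiffConst_schurPair _).pow n).mul hM), pow_succ', mul_assoc]
    push_cast
    rw [sub_sub]

lemma foldr_phi_mode (L : List ℕ+) (e : ℕ+ → ℕ) (l : ℤ) (k : ℕ) {M : XY⟦X⟧} (hM : IsDiffConst M) :
    L.foldr (fun (i : ℕ+) (F : Boson) => (phi (-((i : ℕ) : ℤ)))^[e i] F) (mode l k M) =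
        mode (l - ((L.map e).sum : ℕ)) k ((L.map fun i => schurPair i.natPred ^ e i).prod * M) ∧
      IsDiffConst ((L.map fun i => schurPair i.natPred ^ e i).prod * M) := by
  induction L with
  | nil => simpa using hM
  | cons i L ih =>
    rw [List.foldr_cons, ih.1, phi_iterate_mode ih.2, List.map_cons, List.map_cons, List.prod_cons,
      List.sum_cons, mul_assoc]
    refine ⟨?_, ((isDiffConst_schurPair _).pow _).mul ih.2⟩
    push_cast
    rw [sub_sub, add_comm (e i : ℤ)]

/-- Once φ*₀ has acted, each φ₋ᵢ is multiplication by a series, so the ordering in the basis vector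
disappears. `S` may be any finite set containing the indices that occur. -/
lemma fmsMonomial_eq_mode (d : Creation →₀ ℕ) (hd : ∀ j, j ≠ 0 → d (Sum.inr j) = 0)
    (S : Finset ℕ+) (hS : ∀ i ∉ S, d (Sum.inl i) = 0) :
    fmsMonomial d = ((d (Sum.inr 0))! : ℂ) •
      mode (d (Sum.inr 0) - (∑ i ∈ S, d (Sum.inl i) : ℕ)) (d (Sum.inr 0))
        (∏ i ∈ S, schurPair i.natPred ^ d (Sum.inl i)) := by
  have hstar : ((Finsupp.sumFinsuppEquivProdFinsupp d).2.support.sort (fun i j => j ≤ i)).foldr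
      (fun (j : ℕ) (F : Boson) => (phiStar (-(j : ℤ)))^[d (Sum.inr j)] F) vac =
        (phiStar 0)^[d (Sum.inr 0)] vac := by
    have hsub : (Finsupp.sumFinsuppEquivProdFinsupp d).2.support ⊆ {0} := fun j hj => by
      rw [Finsupp.mem_support_iff, Finsupp.snd_sumFinsuppEquivProdFinsupp] at hj
      exact mem_singleton.2 (not_not.1 fun h => hj (hd j h))
    rcases subset_singleton_iff.1 hsub with h | h
    · have h0 : d (Sum.inr 0) = 0 := by
        rw [← Finsupp.snd_sumFinsuppEquivProdFinsupp, ← Finsupp.notMem_support_iff, h]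
        exact notMem_empty _
      rw [h, h0, sort_empty]
      rfl
    · rw [h, sort_singleton]
      simp
  have hsub : (Finsupp.sumFinsuppEquivProdFinsupp d).1.support ⊆ S := fun i hi => by
    rw [Finsupp.mem_support_iff, Finsupp.fst_sumFinsuppEquivProdFinsupp] at hi
    exact not_not.1 fun h => hi (hS i h)
  have hnot (i : ℕ+) (hi : i ∉ (Finsupp.sumFinsuppEquivProdFinsupp d).1.support) :
      d (Sum.inl i) = 0 := by
    rwa [Finsupp.notMem_support_iff, Finsupp.fst_sumFinsuppEquivProdFinsupp] at hi
  have hone : IsDiffConst ((d (Sum.inr 0))! • 1 : XY⟦X⟧) := fun n => by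
    rw [map_nsmul, map_nsmul, Derivation.map_one_eq_zero, Derivation.map_one_eq_zero]
  rw [fmsMonomial, hstar, phiStar_iterate_vac, Nat.cast_smul_eq_nsmul, ← map_nsmul,
    (foldr_phi_mode _ _ _ _ hone).1, ← sum_subset hsub fun i _ hi => hnot i hi,
    ← prod_subset hsub fun i _ hi => by rw [hnot i hi, pow_zero], mul_smul_comm, mul_one, map_nsmul,
    Nat.cast_smul_eq_nsmul]
  congr 2
  · congr 2
    rw [← Multiset.sum_coe, ← Multiset.map_coe, sort_eq]
    rfl
  · rw [← Multiset.prod_coe, ← Multiset.map_coe, sort_eq]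
    rfl

/-! ### The exponential in the Fock space -/

/-- The exponent of `∏ⱼ φ₋ⱼ^(nⱼ) φ*₀ᵏ`, where `nⱼ₊₁ = κ j` for `j < s`. -/
def fockExponent (s k : ℕ) (κ : ℕ → ℕ) : Creation →₀ ℕ :=
  ∑ j ∈ range s, Finsupp.single (Sum.inl j.succPNat) (κ j) + Finsupp.single (Sum.inr 0) k

lemma fockExponent_inr (s k : ℕ) (κ : ℕ → ℕ) (j : ℕ) :
    fockExponent s k κ (Sum.inr j) = if j = 0 then k else 0 := by
  simp [fockExponent, Finsupp.single_apply, eq_comm]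

lemma fockExponent_inl (s k : ℕ) (κ : ℕ → ℕ) {j : ℕ} (hj : j < s) :
    fockExponent s k κ (Sum.inl j.succPNat) = κ j := by
  simp [fockExponent, Finsupp.single_apply, Nat.succPNat_inj, hj]

lemma fockExponent_inl_of_notMem (s k : ℕ) (κ : ℕ → ℕ) {i : ℕ+}
    (hi : i ∉ (range s).image Nat.succPNat) : fockExponent s k κ (Sum.inl i) = 0 := by
  simp only [fockExponent, Finsupp.add_apply, Finsupp.finsetSum_apply, Finsupp.single_apply,
    reduceCtorEq, if_false, add_zero, Sum.inl.injEq]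
  exact sum_eq_zero fun j hj => if_neg fun h => hi (mem_image.2 ⟨j, hj, h⟩)

lemma fmsMonomial_fockExponent {s k : ℕ} {κ : ℕ → ℕ} (hκ : κ ∈ piAntidiag (range s) k) :
    fmsMonomial (fockExponent s k κ) =
      (k ! : ℂ) • mode 0 k (∏ j ∈ range s, schurPair j ^ κ j) := by
  have hinj : Set.InjOn Nat.succPNat (range s : Set ℕ) := fun _ _ _ _ h => Nat.succPNat_injective h
  rw [fmsMonomial_eq_mode _ (fun j hj => by rw [fockExponent_inr, if_neg hj])
    ((range s).image Nat.succPNat) fun i hi => fockExponent_inl_of_notMem s k κ hi,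
    sum_image hinj, prod_image hinj, fockExponent_inr, if_pos rfl,
    sum_congr rfl fun j hj => fockExponent_inl s k κ (mem_range.1 hj),
    prod_congr rfl fun j hj => by rw [fockExponent_inl s k κ (mem_range.1 hj), Nat.natPred_succPNat],
    (mem_piAntidiag.1 hκ).1, sub_self]

/-- The element `∑ⱼ aⱼ φ₋ⱼ φ*₀` of the Fock space. -/
def fockLinear (s : ℕ) (a : ℕ → ℂ) : Fock :=
  ∑ j ∈ range s, a (j + 1) •
    (MvPowerSeries.X (Sum.inl j.succPNat) * MvPowerSeries.X (Sum.inr 0) : Fock)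

lemma fockTau_eq (s : ℕ) (a : ℕ → ℂ) : fockTau s a = formalExp (fockLinear s a) := by
  rw [fockTau, fockLinear, ← Fin.sum_univ_eq_sum_range (fun j => a (j + 1) •
    (MvPowerSeries.X (Sum.inl j.succPNat) * MvPowerSeries.X (Sum.inr 0) : Fock))]

/-- The coefficient of a monomial in the multinomial expansion. -/
def multinomialCoeff (s : ℕ) (a : ℕ → ℂ) (κ : ℕ → ℕ) : ℂ :=
  Nat.multinomial (range s) κ * ∏ j ∈ range s, a (j + 1) ^ κ j

lemma smul_sum_pow {A : Type} [CommRing A] [Algebra ℂ A] (s : ℕ) (a : ℕ → ℂ) (f : ℕ → A) (k : ℕ) :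
    (∑ j ∈ range s, a (j + 1) • f j) ^ k =
      ∑ κ ∈ piAntidiag (range s) k, multinomialCoeff s a κ • ∏ j ∈ range s, f j ^ κ j := by
  rw [sum_pow_eq_sum_piAntidiag]
  refine sum_congr rfl fun κ _ => ?_
  simp only [smul_pow, prod_smul]
  rw [multinomialCoeff, mul_smul, Nat.cast_smul_eq_nsmul, nsmul_eq_mul]

lemma prod_X_mul_X_pow {s k : ℕ} {κ : ℕ → ℕ} (hκ : κ ∈ piAntidiag (range s) k) :
    ∏ j ∈ range s, (MvPowerSeries.X (Sum.inl j.succPNat) * MvPowerSeries.X (Sum.inr 0) : Fock) ^ κ j =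
      MvPowerSeries.monomial (fockExponent s k κ) 1 := by
  simp only [mul_pow, prod_mul_distrib]
  rw [prod_pow_eq_pow_sum, (mem_piAntidiag.1 hκ).1]
  simp only [MvPowerSeries.X_pow_eq]
  have h : ∏ j ∈ range s, (MvPowerSeries.monomial (Finsupp.single (Sum.inl j.succPNat) (κ j)) 1 : Fock) =
      MvPowerSeries.monomial (∑ j ∈ range s, Finsupp.single (Sum.inl j.succPNat) (κ j)) 1 := by
    generalize range s = t
    induction t using Finset.cons_induction with
    | empty => rfl
    | cons i t hi ih =>
      rw [prod_cons, sum_cons, ih, MvPowerSeries.monomial_mul_monomial, one_mul]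
  rw [h, MvPowerSeries.monomial_mul_monomial, one_mul, fockExponent]

lemma coeff_fockLinear_pow (s : ℕ) (a : ℕ → ℂ) (k : ℕ) (d : Creation →₀ ℕ) :
    MvPowerSeries.coeff d (fockLinear s a ^ k) =
      ∑ κ ∈ piAntidiag (range s) k, if d = fockExponent s k κ then multinomialCoeff s a κ else 0 := by
  classical
  rw [fockLinear, smul_sum_pow, map_sum]
  refine sum_congr rfl fun κ hκ => ?_
  rw [prod_X_mul_X_pow hκ, map_smul, MvPowerSeries.coeff_monomial, smul_eq_mul, mul_ite, mul_one,
    mul_zero]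

/-- The exponents which occur in `(∑ⱼ aⱼ φ₋ⱼ φ*₀)ᵏ`. -/
def fockExponents (s k : ℕ) : Finset (Creation →₀ ℕ) :=
  (piAntidiag (range s) k).image (fockExponent s k)

lemma apply_inr_zero_of_mem {s k : ℕ} {d : Creation →₀ ℕ} (hd : d ∈ fockExponents s k) :
    d (Sum.inr 0) = k := by
  obtain ⟨κ, _, rfl⟩ := mem_image.1 hd
  rw [fockExponent_inr, if_pos rfl]

lemma coeff_fockLinear_pow_eq_zero {s : ℕ} {a : ℕ → ℂ} {k : ℕ} {d : Creation →₀ ℕ}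
    (hd : d ∉ fockExponents s k) : MvPowerSeries.coeff d (fockLinear s a ^ k) = 0 := by
  rw [coeff_fockLinear_pow]
  exact sum_eq_zero fun κ hκ => if_neg fun h => hd (mem_image.2 ⟨κ, hκ, h.symm⟩)

/-- The exponent of φ*₀ in a monomial tells which power of the linear form it comes from, so one
term of the exponential contributes. -/
lemma coeff_fockTau (s : ℕ) (a : ℕ → ℂ) (d : Creation →₀ ℕ) :
    MvPowerSeries.coeff d (fockTau s a) =
      (((d (Sum.inr 0))! : ℂ)⁻¹) * MvPowerSeries.coeff d (fockLinear s a ^ d (Sum.inr 0)) := by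
  rw [fockTau_eq]
  refine (finsum_eq_single _ (d (Sum.inr 0)) fun k hk => ?_).trans (map_smul _ _ _)
  rw [map_smul, coeff_fockLinear_pow_eq_zero fun h => hk (apply_inr_zero_of_mem h).symm, smul_zero]

lemma sum_fockExponents (s : ℕ) (a : ℕ → ℂ) (k : ℕ) :
    ∑ d ∈ fockExponents s k, MvPowerSeries.coeff d (fockTau s a) • fmsMonomial d =
      mode 0 k (pairSum s a ^ k) := by
  classical
  have hterm (d) (hd : d ∈ fockExponents s k) :
      MvPowerSeries.coeff d (fockTau s a) • fmsMonomial d =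
        ∑ κ ∈ piAntidiag (range s) k, if d = fockExponent s k κ then
          multinomialCoeff s a κ • mode 0 k (∏ j ∈ range s, schurPair j ^ κ j) else 0 := by
    rw [coeff_fockTau, apply_inr_zero_of_mem hd, coeff_fockLinear_pow, mul_sum, sum_smul]
    refine sum_congr rfl fun κ hκ => ?_
    split_ifs with h
    · rw [h, fmsMonomial_fockExponent hκ, smul_smul, mul_right_comm,
        inv_mul_cancel₀ (by exact_mod_cast k.factorial_ne_zero), one_mul]
    · rw [mul_zero, zero_smul]
  -- Exchanging the sums over d and κ leaves exactly one d for each κ, so injectivity of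
  -- `fockExponent` is not needed.
  rw [sum_congr rfl hterm, sum_comm, pairSum, smul_sum_pow, map_sum]
  refine sum_congr rfl fun κ hκ => ?_
  have hmem : fockExponent s k κ ∈ fockExponents s k := mem_image_of_mem _ hκ
  rw [sum_ite_eq', if_pos hmem, map_smul]

lemma isGraded_prod_schurPair (s : ℕ) (κ : ℕ → ℕ) :
    IsGraded (∏ j ∈ range s, schurPair j ^ κ j) :=
  isGraded_prod _ fun j _ => (isGraded_schurPair j).pow _

lemma coeff_smul_fmsMonomial_eq_zero {s : ℕ} {a : ℕ → ℂ} {l : ℤ} {e : Var →₀ ℕ}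
    {d : Creation →₀ ℕ} (hd : d ∉ (range (weight e + 1)).biUnion (fockExponents s)) :
    MvPowerSeries.coeff e ((MvPowerSeries.coeff d (fockTau s a) • fmsMonomial d) l) = 0 := by
  by_cases h : d ∈ fockExponents s (d (Sum.inr 0))
  · have hlt : weight e < d (Sum.inr 0) := by
      by_contra! hle
      exact hd (mem_biUnion.2 ⟨_, mem_range.2 (Nat.lt_succ_of_le hle), h⟩)
    obtain ⟨κ, hκ, hd'⟩ := mem_image.1 h
    rw [← hd', fmsMonomial_fockExponent hκ, Pi.smul_apply, Pi.smul_apply, map_smul, map_smul,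
      coeff_mode_eq_zero (isGraded_prod_schurPair s κ) hlt, smul_zero, smul_zero]
  · rw [coeff_fockTau, coeff_fockLinear_pow_eq_zero h, mul_zero, zero_smul]
    rfl

lemma hasBosonSum_fockTau (s : ℕ) (a : ℕ → ℂ) :
    HasBosonSum (fun d : Creation →₀ ℕ => MvPowerSeries.coeff d (fockTau s a) • fmsMonomial d)
      (ofXY (tauFormula s a)) := by
  classical
  have hsub (l : ℤ) (e : Var →₀ ℕ) :
      {d | MvPowerSeries.coeff e ((MvPowerSeries.coeff d (fockTau s a) • fmsMonomial d) l) ≠ 0} ⊆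
        (range (weight e + 1)).biUnion (fockExponents s) := fun d hd => by
    by_contra h
    exact hd (coeff_smul_fmsMonomial_eq_zero h)
  refine ⟨fun l e => (finite_toSet _).subset (hsub l e), ?_⟩
  funext l
  ext e
  rw [coeff_ofXY_tauFormula]
  refine (finsum_eq_sum_of_support_subset _ (hsub l e)).trans ?_
  -- The sets for different k are disjoint, because k is the exponent of φ*₀.
  rw [sum_biUnion]
  · refine sum_congr rfl fun k _ => ?_
    rw [← sum_fockExponents, Finset.sum_apply, map_sum]
  · intro k _ k' _ hk
    refine disjoint_left.2 fun d hd hd' => hk ?_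
    rw [← apply_inr_zero_of_mem hd, ← apply_inr_zero_of_mem hd']

end FMS

end

theorem theorem3p5 (s : ℕ) (a : ℕ → ℂ) :
    FMS.HasBosonSum (fun k : ℕ => ((k ! : ℂ)⁻¹) • (FMS.expOp s a)^[k] FMS.vac)
        (FMS.ofXY (FMS.tauFormula s a)) ∧
      FMS.HasBosonSum
        (fun d : FMS.Creation →₀ ℕ =>
          MvPowerSeries.coeff d (FMS.fockTau s a) • FMS.fmsMonomial d)
        (FMS.ofXY (FMS.tauFormula s a)) ∧
      FMS.fms (FMS.fockTau s a) = FMS.ofXY (FMS.tauFormula s a) :=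
  ⟨FMS.hasBosonSum_expOp s a, FMS.hasBosonSum_fockTau s a, (FMS.hasBosonSum_fockTau s a).2⟩
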